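/- For a non-negative integer $\eta$, a graph is $\eta$-balanced if the numbers of vertices of any two of its connected components differ by at most $\eta$; a cluster graph is a graph in which every connected component is a clique. In the problem Balanced Cluster Deletion we are given a finite simple graph $G$ and non-negative integers $k$ and $\eta$, and we have to decide whether there is a set $F \subseteq E(G)$ with $|F| \le k$ such that $G - F$ is an $\eta$-balanced cluster graph. Theorem. Balanced Cluster Deletion, parameterized by $k$, admits a kernel with $O(k^4)$ vertices. That is, there are a constant $C$ and an algorithm that, given an instance $(G, k, \eta)$, runs in time polynomial in the length of the instance (adjacency matrix of $G$, with $k$ and $\eta$ in binary) and returns an instance $(G', k', \eta')$ such that - $(G', k', \eta')$ is a yes-instance if and only if $(G, k, \eta)$ is a yes-instance; - the encoding length of $(G', k', \eta')$ plus $k'$ is at most $g(k)$ for some computable function $g$ that depends only on the problem; - $|V(G')| \le C\,(k^4 + 1)$. -/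

import Mathlib

namespace BCD

/-! ### Balanced Cluster Deletion -/

/-- A cluster graph: every connected component is a clique. -/
def IsClusterGraph {V : Type*} (G : SimpleGraph V) : Prop :=
  ∀ c : G.ConnectedComponent, G.IsClique c.supp

/-- `η`-balanced: the sizes (numbers of vertices) of any two connected components differ by at
most `η`. The condition is stated for all ordered pairs of components. -/
def IsBalanced {V : Type*} (η : ℕ) (G : SimpleGraph V) : Prop :=
  ∀ c d : G.ConnectedComponent, c.supp.ncard ≤ d.supp.ncard + η

/-- An instance `(G, k, η)`, where `G` is a graph with vertex set `{0, …, n - 1}`. -/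
structure Instance where
  n : ℕ
  G : SimpleGraph (Fin n)
  k : ℕ
  η : ℕ

/-- Yes-instances: one can delete a set `F ⊆ E(G)` of at most `k` edges so that `G - F` is an
`η`-balanced cluster graph. -/
def Instance.IsYes (I : Instance) : Prop :=
  ∃ F : Finset (Sym2 (Fin I.n)), (F : Set (Sym2 (Fin I.n))) ⊆ I.G.edgeSet ∧ F.card ≤ I.k ∧
    IsClusterGraph (I.G.deleteEdges (F : Set (Sym2 (Fin I.n)))) ∧
    IsBalanced I.η (I.G.deleteEdges (F : Set (Sym2 (Fin I.n))))

/-- The length of the encoding of an instance: an `n × n` adjacency matrix, and the numbers `k`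
and `η` written in binary. -/
def Instance.size (I : Instance) : ℕ := I.n ^ 2 + Nat.size I.k + Nat.size I.η

/-! ### Random access machines

Programs work on finitely many unbounded arrays of natural numbers, with indirect addressing.
The arithmetic operations are addition and truncated subtraction, at unit cost. There is no
multiplication, so the bit length of the numbers grows by at most one per step, and polynomial
time in this model is polynomial time on Turing machines. -/

/-- The memory: `M a i` is the content of cell `i` of array `a`. -/
abbrev Memory := ℕ → ℕ → ℕ

/-- Expressions: numerals, the content of cell `e` of array `a`, sums, truncated differences. -/
inductive Expr where
  | lit (c : ℕ)
  | cell (a : ℕ) (e : Expr)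
  | add (e f : Expr)
  | sub (e f : Expr)

/-- The value of an expression. -/
def Expr.eval (M : Memory) : Expr → ℕ
  | lit c => c
  | cell a e => M a (e.eval M)
  | add e f => e.eval M + f.eval M
  | sub e f => e.eval M - f.eval M

/-- The number of elementary operations needed to evaluate an expression. -/
def Expr.cost : Expr → ℕ
  | lit _ => 1
  | cell _ e => e.cost + 1
  | add e f => e.cost + f.cost + 1
  | sub e f => e.cost + f.cost + 1

/-- Programs. `store a e f` writes the value of `f` into cell `e` of array `a`; the tests of
`ite` and `loop` (a while-loop) succeed when the value of the expression is nonzero. -/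
inductive Program where
  | skip
  | store (a : ℕ) (e f : Expr)
  | seq (p q : Program)
  | ite (e : Expr) (p q : Program)
  | loop (e : Expr) (p : Program)

/-- `Exec p M t M'`: the program `p`, started with memory `M`, halts after `t` steps with
memory `M'`. -/
inductive Exec : Program → Memory → ℕ → Memory → Prop
  | skip (M : Memory) : Exec .skip M 1 M
  | store (a : ℕ) (e f : Expr) (M : Memory) :
      Exec (.store a e f) M (e.cost + f.cost + 1)
        (Function.update M a (Function.update (M a) (e.eval M) (f.eval M)))
  | seq {p q : Program} {M M' M'' : Memory} {s t : ℕ} :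
      Exec p M s M' → Exec q M' t M'' → Exec (.seq p q) M (s + t) M''
  | ite_true {e : Expr} {p q : Program} {M M' : Memory} {t : ℕ} :
      e.eval M ≠ 0 → Exec p M t M' → Exec (.ite e p q) M (e.cost + 1 + t) M'
  | ite_false {e : Expr} {p q : Program} {M M' : Memory} {t : ℕ} :
      e.eval M = 0 → Exec q M t M' → Exec (.ite e p q) M (e.cost + 1 + t) M'
  | loop_stop {e : Expr} {p : Program} {M : Memory} :
      e.eval M = 0 → Exec (.loop e p) M (e.cost + 1) M
  | loop_step {e : Expr} {p : Program} {M M' M'' : Memory} {s t : ℕ} :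
      e.eval M ≠ 0 → Exec p M s M' → Exec (.loop e p) M' t M'' →
        Exec (.loop e p) M (e.cost + 1 + s + t) M''

/-! ### Polynomial-time maps between instances, and kernelizations -/

open Classical in
/-- The initial memory on input `(G, k, η)`: the numbers `n`, `k`, `η` stand in cell `0` of the
arrays `0`, `1`, `2`, array `3` holds the adjacency matrix of `G` row by row (the entry for the
pair `(u, v)` is in cell `u * n + v`), and all other cells are zero. -/
noncomputable def Instance.encode (I : Instance) : Memory
  | 0, 0 => I.n
  | 1, 0 => I.k
  | 2, 0 => I.η
  | 3, i => if ∃ u v : Fin I.n, I.G.Adj u v ∧ i = (u : ℕ) * I.n + (v : ℕ) then 1 else 0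
  | _, _ => 0

open Classical in
/-- The instance `J` can be read off the memory `M`, with the same format as for the input; the
cells that are not used by the format are ignored. -/
def Instance.IsOutput (J : Instance) (M : Memory) : Prop :=
  M 0 0 = J.n ∧ M 1 0 = J.k ∧ M 2 0 = J.η ∧
    ∀ u v : Fin J.n, M 3 ((u : ℕ) * J.n + (v : ℕ)) = if J.G.Adj u v then 1 else 0

/-- `K` is computed by a program whose running time is polynomial in the length of the input. -/
def IsPolyTime (K : Instance → Instance) : Prop :=
  ∃ (p : Program) (q : Polynomial ℕ), ∀ I : Instance,
    ∃ (t : ℕ) (M : Memory), Exec p I.encode t M ∧ t ≤ q.eval I.size ∧ (K I).IsOutput M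

/-- A kernelization for the problem parameterized by `k`: a polynomial-time map that sends every
instance to an equivalent instance whose size (and new parameter) is bounded by a computable
function of the parameter `k` alone. -/
def IsKernelization (K : Instance → Instance) : Prop :=
  IsPolyTime K ∧ (∀ I : Instance, (K I).IsYes ↔ I.IsYes) ∧
    ∃ g : ℕ → ℕ, Computable g ∧ ∀ I : Instance, (K I).size + (K I).k ≤ g I.k

end BCD

/-!
The kernel. A set of at most `k` deleted edges touches at most `2 k` vertices, so every set of more
than `2 k` vertices contains an untouched one (`exists_untouched`). Two consequences: a clique with
more than `2 k` vertices is never split (`Sol.unsplit`), and a cluster with more than `2 k` vertices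
is the closed neighbourhood of a vertex `v` for which that neighbourhood is a clique. Conversely,
such a closed neighbourhood is a cluster of every solution (`Sol.rel_big`). The edges that leave
these forced clusters can therefore be deleted at once (`yes_cut_iff`), and in the remaining graph
all clusters with more than `2 k` vertices are connected components (`Sol.iso_of_lt`). The vertices
of the other non-clique components lie in clusters that meet a deleted edge, so there are at most
`(2 k) ^ 2` of them (`Sol.cnt_not_iso`).

What remains are clique components. Among those of a fixed size `s ≤ 2 k`, it suffices to keep
`2 k + 1`: some kept one stays untouched, so that `s` occurs as a cluster size anyway, and the
dropped ones can be left in one piece (`exists_core_of_dropped`). The cliques with more than `2 k`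
vertices are never split. Their sizes are compared with each other directly; if this reveals no
violation, only the largest of them matters for the balance with the smaller clusters. All of them
are replaced by one clique with `2 k + 1` vertices, and `η` is lowered by the number of vertices
that the largest one loses (`Yes.reduce`, `Yes.lift`). The result has `O(k ^ 3)` vertices, and `η`
can be capped by the number of vertices.

Running time. All data of the kernel are definable by expressions that use addition, truncated
subtraction, conditionals, and sums over the vertices; quantifiers and counting are such sums. Each
such expression is evaluated by a program in time polynomial in the number of vertices
(`Ex.comp_runs`), and the program for the kernel tabulates a fixed list of them
(`Cmd.progs_runs`, `analysis`, `output`).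
-/

namespace BCD

/-! ### Counting -/

section Counting

open Classical in
/-- The number of elements of a finite type that satisfy `P`. -/
noncomputable def cnt {V : Type*} [Fintype V] (P : V → Prop) : ℕ := (Finset.univ.filter P).card

variable {V W : Type*} [Fintype V] [Fintype W]

lemma cnt_eq_card (P : V → Prop) [DecidablePred P] : cnt P = (Finset.univ.filter P).card := by
  unfold cnt; congr

lemma cnt_congr {P Q : V → Prop} (h : ∀ v, P v ↔ Q v) : cnt P = cnt Q := by
  rw [show P = Q from funext fun v => propext (h v)]

lemma cnt_mono {P Q : V → Prop} (h : ∀ v, P v → Q v) : cnt P ≤ cnt Q := by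
  classical
  exact Finset.card_le_card (Finset.monotone_filter_right _ fun v _ => h v)

lemma cnt_le_card (P : V → Prop) : cnt P ≤ Fintype.card V := by
  classical
  exact Finset.card_le_univ _

lemma cnt_or_le (P Q : V → Prop) : cnt (fun v => P v ∨ Q v) ≤ cnt P + cnt Q := by
  classical
  rw [cnt_eq_card (fun v => P v ∨ Q v), Finset.filter_or, cnt_eq_card P, cnt_eq_card Q]
  exact Finset.card_union_le _ _

lemma cnt_or_eq {P Q : V → Prop} (h : ∀ v, P v → ¬ Q v) :
    cnt (fun v => P v ∨ Q v) = cnt P + cnt Q := by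
  classical
  rw [cnt_eq_card (fun v => P v ∨ Q v), Finset.filter_or, cnt_eq_card P, cnt_eq_card Q,
    Finset.card_union_of_disjoint]
  exact Finset.disjoint_filter.2 fun v _ => h v

/-- If `Q` holds on a set that `f` maps onto `P`, then `P` is no larger than `Q`. -/
lemma cnt_le_of_surj {P : V → Prop} {Q : W → Prop} (f : W → V)
    (h : ∀ v, P v → ∃ w, Q w ∧ f w = v) : cnt P ≤ cnt Q := by
  classical
  have : Finset.univ.filter P ⊆ (Finset.univ.filter Q).image f := by
    intro v hv
    obtain ⟨w, hw, rfl⟩ := h v (Finset.mem_filter.1 hv).2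
    exact Finset.mem_image_of_mem _ (by simp [hw])
  exact (Finset.card_le_card this).trans Finset.card_image_le

lemma cnt_le_of_inj {P : V → Prop} {Q : W → Prop} (f : V → W) (hf : Function.Injective f)
    (h : ∀ v, P v → Q (f v)) : cnt P ≤ cnt Q := by
  classical
  unfold cnt
  rw [← Finset.card_image_of_injective _ hf]
  apply Finset.card_le_card
  intro w hw
  obtain ⟨v, hv, rfl⟩ := Finset.mem_image.1 hw
  simpa using h v (Finset.mem_filter.1 hv).2

lemma cnt_lt_cnt {P Q : V → Prop} (h : ∀ v, P v → Q v) {v : V} (hv : Q v) (hn : ¬ P v) :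
    cnt P < cnt Q := by
  classical
  apply Finset.card_lt_card
  refine ⟨Finset.monotone_filter_right _ fun v _ => h v, fun hs => hn ?_⟩
  exact (Finset.mem_filter.1 (hs (Finset.mem_filter.2 ⟨Finset.mem_univ v, hv⟩))).2

lemma cnt_pos_of {P : V → Prop} {v : V} (h : P v) : 0 < cnt P := by
  classical
  exact Finset.card_pos.2 ⟨v, by simp [h]⟩

/-- A set covered by `a` sets of size at most `b` has at most `a * b` elements. -/
lemma cnt_le_mul {ι : Type*} (s : Finset ι) (Q : ι → V → Prop) {P : V → Prop} {a b : ℕ}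
    (hs : s.card ≤ a) (hQ : ∀ i ∈ s, cnt (Q i) ≤ b) (h : ∀ v, P v → ∃ i ∈ s, Q i v) :
    cnt P ≤ a * b := by
  classical
  have : Finset.univ.filter P ⊆ s.biUnion fun i => Finset.univ.filter (Q i) := by
    intro v hv
    obtain ⟨i, hi, hq⟩ := h v (Finset.mem_filter.1 hv).2
    simpa using ⟨i, hi, hq⟩
  calc cnt P ≤ _ := Finset.card_le_card this
    _ ≤ s.card * b := Finset.card_biUnion_le_card_mul _ _ _ hQ
    _ ≤ a * b := Nat.mul_le_mul_right _ hs

lemma cnt_prod (P : V → W → Prop) :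
    cnt (fun p : V × W => P p.1 p.2) = ∑ u, cnt (P u) := by
  classical
  simp only [cnt, Finset.card_filter, Fintype.sum_prod_type]

/-- The rank of `v` among the elements that satisfy `P`. -/
noncomputable def rank [LinearOrder V] (P : V → Prop) (v : V) : ℕ := cnt fun u => u < v ∧ P u

lemma rank_lt [LinearOrder V] {P : V → Prop} {u v : V} (h : u < v) (hu : P u) :
    rank P u < rank P v :=
  cnt_lt_cnt (fun _ hw => ⟨hw.1.trans h, hw.2⟩) (v := u) ⟨h, hu⟩ fun h' => lt_irrefl _ h'.1

lemma rank_inj [LinearOrder V] {P : V → Prop} {u v : V} (hu : P u) (hv : P v)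
    (h : rank P u = rank P v) : u = v := by
  rcases lt_trichotomy u v with h1 | h1 | h1
  · exact absurd (rank_lt h1 hu) (by omega)
  · exact h1
  · exact absurd (rank_lt h1 hv) (by omega)

lemma rank_lt_cnt [LinearOrder V] {P : V → Prop} {v : V} (hv : P v) : rank P v < cnt P :=
  cnt_lt_cnt (fun _ hw => hw.2) hv fun h => lt_irrefl _ h.1

/-- There are `min m (cnt P)` elements of rank less than `m`. -/
lemma cnt_rank_lt [LinearOrder V] (P : V → Prop) (m : ℕ) :
    cnt (fun v => P v ∧ rank P v < m) = min m (cnt P) := by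
  classical
  have himg : (Finset.univ.filter P).image (rank P) = Finset.range (cnt P) := by
    apply Finset.eq_of_subset_of_card_le
    · intro i hi
      obtain ⟨v, hv, rfl⟩ := Finset.mem_image.1 hi
      exact Finset.mem_range.2 (rank_lt_cnt (Finset.mem_filter.1 hv).2)
    · rw [Finset.card_image_of_injOn, Finset.card_range, cnt_eq_card]
      intro u hu v hv h
      simp only [Finset.coe_filter, Finset.mem_univ, true_and, Set.mem_ofPred_eq] at hu hv
      exact rank_inj hu hv h
  have h2 : (Finset.univ.filter fun v => P v ∧ rank P v < m).image (rank P) =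
      Finset.range (min m (cnt P)) := by
    ext i
    have := Finset.ext_iff.1 himg i
    simp only [Finset.mem_image, Finset.mem_filter, Finset.mem_univ, true_and,
      Finset.mem_range] at this
    simp only [Finset.mem_image, Finset.mem_filter, Finset.mem_univ, true_and,
      Finset.mem_range, lt_min_iff, ← this]
    constructor
    · rintro ⟨v, ⟨hv, h1⟩, rfl⟩
      exact ⟨h1, v, hv, rfl⟩
    · rintro ⟨h1, v, hv, rfl⟩
      exact ⟨v, ⟨hv, h1⟩, rfl⟩
  rw [cnt_eq_card, ← Finset.card_range (min m (cnt P)), ← h2, Finset.card_image_of_injOn]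
  intro u hu v hv h
  simp only [Finset.coe_filter, Finset.mem_univ, true_and, Set.mem_ofPred_eq] at hu hv
  exact rank_inj hu.1 hv.1 h

end Counting

/-! ### Cluster graphs as transitive relations -/

section Clusters

variable {V : Type*} [Fintype V]

/-- `Rel G u v`: the vertex `v` lies in the closed neighbourhood of `u`. -/
def Rel {V : Type*} (G : SimpleGraph V) (u v : V) : Prop := u = v ∨ G.Adj u v

lemma Rel.refl {V : Type*} (G : SimpleGraph V) (u : V) : Rel G u u := Or.inl rfl

lemma Rel.symm {V : Type*} {G : SimpleGraph V} {u v : V} (h : Rel G u v) : Rel G v u :=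
  h.imp Eq.symm fun h => h.symm

lemma Rel.mono {V : Type*} {G H : SimpleGraph V} (hl : H ≤ G) {u v : V} (h : Rel H u v) :
    Rel G u v := h.imp_right fun h => hl h

/-- The size of the closed neighbourhood; in a cluster graph this is the size of the cluster. -/
noncomputable def nsize (G : SimpleGraph V) (u : V) : ℕ := cnt (Rel G u)

/-- Lying in a common closed neighbourhood is transitive; this says that `H` is a cluster graph. -/
def Cl {V : Type*} (H : SimpleGraph V) : Prop := ∀ u v w, Rel H u v → Rel H v w → Rel H u w

/-- The number of ordered pairs that are adjacent in `G` and not in `H`: twice the number of edges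
deleted in passing from `G` to `H ≤ G`. -/
noncomputable def cost (G H : SimpleGraph V) : ℕ :=
  cnt fun p : V × V => G.Adj p.1 p.2 ∧ ¬ H.Adj p.1 p.2

/-- `H` arises from `G` by deleting at most `k` edges, and is a cluster graph. -/
structure Sol (G : SimpleGraph V) (k : ℕ) (H : SimpleGraph V) : Prop where
  le : H ≤ G
  cl : Cl H
  cost_le : cost G H ≤ 2 * k

/-- Yes-instances on an arbitrary finite vertex type. -/
def Yes (G : SimpleGraph V) (k η : ℕ) : Prop :=
  ∃ H, Sol G k H ∧ ∀ u v, nsize H u ≤ nsize H v + η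

lemma Cl.reachable {V : Type*} {H : SimpleGraph V} (hH : Cl H) {u v : V} :
    H.Reachable u v ↔ Rel H u v := by
  constructor
  · rintro ⟨p⟩
    induction p with
    | nil => exact Rel.refl _ _
    | cons h _ ih => exact hH _ _ _ (Or.inr h) ih
  · rintro (rfl | h)
    · rfl
    · exact h.reachable

lemma isClusterGraph_iff {V : Type*} (H : SimpleGraph V) : IsClusterGraph H ↔ Cl H := by
  constructor
  · intro h u v w huv hvw
    have hr : ∀ {a b}, Rel H a b → H.Reachable a b := by
      rintro a b (rfl | h)
      · rfl
      · exact h.reachable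
    by_cases e : u = w
    · exact Or.inl e
    · exact Or.inr (h (H.connectedComponentMk u) rfl
        (SimpleGraph.ConnectedComponent.eq.2 (((hr huv).trans (hr hvw)).symm)) e)
  · intro h c u hu v hv huv
    have : H.Reachable u v := SimpleGraph.ConnectedComponent.eq.1
      (((SimpleGraph.ConnectedComponent.mem_supp_iff _ _).1 hu).trans
        ((SimpleGraph.ConnectedComponent.mem_supp_iff _ _).1 hv).symm)
    exact (h.reachable.1 this).resolve_left huv

lemma Cl.ncard_supp {H : SimpleGraph V} (hH : Cl H) (u : V) :
    (H.connectedComponentMk u).supp.ncard = nsize H u := by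
  classical
  have : (H.connectedComponentMk u).supp = ((Finset.univ.filter (Rel H u) : Finset V) : Set V) := by
    ext v
    simp only [SimpleGraph.ConnectedComponent.mem_supp_iff, SimpleGraph.ConnectedComponent.eq,
      Finset.coe_filter, Finset.mem_univ, true_and, Set.mem_ofPred_eq, hH.reachable]
    exact ⟨Rel.symm, Rel.symm⟩
  rw [this, Set.ncard_coe_finset, nsize, cnt_eq_card]

lemma isBalanced_iff {H : SimpleGraph V} (hH : Cl H) (η : ℕ) :
    IsBalanced η H ↔ ∀ u v, nsize H u ≤ nsize H v + η := by
  constructor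
  · intro h u v
    simpa only [hH.ncard_supp] using h (H.connectedComponentMk u) (H.connectedComponentMk v)
  · intro h c d
    induction c using SimpleGraph.ConnectedComponent.ind with | _ u
    induction d using SimpleGraph.ConnectedComponent.ind with | _ v
    simpa only [hH.ncard_supp] using h u v

lemma cost_eq_twice (G H : SimpleGraph V) (F : Finset (Sym2 V))
    (hF : (F : Set (Sym2 V)) = (G \ H).edgeSet) : cost G H = 2 * F.card := by
  classical
  have h1 := (G \ H).sum_degrees_eq_twice_card_edges
  have h2 : (G \ H).edgeFinset = F := by
    apply Finset.coe_injective
    rw [SimpleGraph.coe_edgeFinset, hF]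
  have h3 : 2 * F.card = ∑ v, (G \ H).degree v := by
    rw [h1]
    subst h2
    congr!
  rw [h3, cost, cnt_prod (fun u v => G.Adj u v ∧ ¬ H.Adj u v)]
  refine Finset.sum_congr rfl fun u _ => ?_
  rw [← SimpleGraph.card_neighborFinset_eq_degree, cnt_eq_card]
  congr 1
  ext v
  simp

lemma isYes_iff (I : Instance) : I.IsYes ↔ Yes I.G I.k I.η := by
  classical
  constructor
  · rintro ⟨F, hF, hk, hc, hb⟩
    have hcl := (isClusterGraph_iff _).1 hc
    refine ⟨_, ⟨SimpleGraph.deleteEdges_le _, hcl, ?_⟩, (isBalanced_iff hcl _).1 hb⟩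
    rw [cost_eq_twice _ _ F]
    · omega
    · ext e
      induction e with | _ u v
      simp only [SimpleGraph.mem_edgeSet, SimpleGraph.sdiff_adj, SimpleGraph.deleteEdges_adj]
      constructor
      · intro h
        exact ⟨hF h, fun h' => h'.2 h⟩
      · rintro ⟨h, h'⟩
        by_contra hc
        exact h' ⟨h, hc⟩
  · rintro ⟨H, ⟨hle, hcl, hk⟩, hb⟩
    have e : I.G.deleteEdges (((I.G \ H).edgeFinset : Finset _) : Set (Sym2 (Fin I.n))) = H := by
      ext u v
      simp only [SimpleGraph.deleteEdges_adj, SimpleGraph.coe_edgeFinset, SimpleGraph.mem_edgeSet,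
        SimpleGraph.sdiff_adj]
      constructor
      · rintro ⟨h, h'⟩
        by_contra hc
        exact h' ⟨h, hc⟩
      · intro h
        exact ⟨hle h, fun h' => h'.2 h⟩
    refine ⟨(I.G \ H).edgeFinset, ?_, ?_, ?_, ?_⟩
    · rw [SimpleGraph.coe_edgeFinset]
      exact SimpleGraph.edgeSet_mono sdiff_le
    · have := cost_eq_twice I.G H _ (SimpleGraph.coe_edgeFinset _)
      omega
    · rw [e]; exact (isClusterGraph_iff _).2 hcl
    · rw [e]; exact (isBalanced_iff hcl _).2 hb

lemma yes_min_card (G : SimpleGraph V) (k η m : ℕ) (hm : Fintype.card V ≤ m) :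
    Yes G k (min η m) ↔ Yes G k η := by
  refine exists_congr fun H => and_congr_right fun _ => forall₂_congr fun u v => ?_
  have := cnt_le_card (Rel H u)
  change nsize H u ≤ _ at this
  omega

/-- Twice the number of pairs `u < v` is the number of ordered pairs. -/
lemma cost_eq_two_mul [LinearOrder V] (G H : SimpleGraph V) :
    cost G H = 2 * ∑ u, cnt fun v => u < v ∧ G.Adj u v ∧ ¬ H.Adj u v := by
  rw [cost, ← cnt_prod (fun u v => u < v ∧ G.Adj u v ∧ ¬ H.Adj u v), two_mul]
  have h1 : cnt (fun p : V × V => p.1 < p.2 ∧ G.Adj p.1 p.2 ∧ ¬ H.Adj p.1 p.2) =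
      cnt (fun p : V × V => p.2 < p.1 ∧ G.Adj p.1 p.2 ∧ ¬ H.Adj p.1 p.2) := by
    apply le_antisymm <;>
    · apply cnt_le_of_inj Prod.swap Prod.swap_injective
      rintro ⟨u, v⟩ ⟨h1, h2, h3⟩
      exact ⟨h1, h2.symm, fun h => h3 h.symm⟩
  conv_rhs => rw [h1]
  nth_rewrite 1 [← h1]
  rw [← cnt_or_eq]
  · refine cnt_congr fun p => ⟨fun h => ?_, fun h => h.elim And.right And.right⟩
    rcases lt_or_gt_of_ne h.1.ne with h' | h'
    · exact Or.inl ⟨h', h⟩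
    · exact Or.inr ⟨h', h⟩
  · intro p h h'
    exact lt_asymm h.1 h'.1

end Clusters

/-! ### Forced clusters -/

section Forced

variable {V : Type*} [Fintype V]

/-- More than `2 k` vertices contain one that is incident to none of at most `k` deleted edges. -/
lemma exists_untouched {G H : SimpleGraph V} {k : ℕ} (hc : cost G H ≤ 2 * k) {P : V → Prop}
    (hP : 2 * k < cnt P) : ∃ v, P v ∧ ∀ w, Rel G v w → Rel H v w := by
  by_contra! h
  have : cnt P ≤ cost G H := by
    refine cnt_le_of_surj Prod.fst fun v hv => ?_
    obtain ⟨w, h1, h2⟩ := h v hv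
    refine ⟨(v, w), ⟨h1.resolve_left ?_, fun h3 => h2 (Or.inr h3)⟩, rfl⟩
    rintro rfl
    exact h2 (Rel.refl _ _)
  omega

/-- A clique with more than `2 k` vertices cannot be split. -/
lemma Sol.unsplit {G H : SimpleGraph V} {k : ℕ} (hs : Sol G k H) {P : V → Prop}
    (hP : 2 * k < cnt P) (hq : ∀ a b, P a → P b → Rel G a b) {a b : V} (ha : P a) (hb : P b) :
    Rel H a b := by
  obtain ⟨v, hv, h⟩ := exists_untouched hs.cost_le hP
  exact hs.cl _ _ _ (h a (hq _ _ hv ha)).symm (h b (hq _ _ hv hb))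

/-- The closed neighbourhood of `v` is a clique with more than `2 k` vertices. -/
def Big (G : SimpleGraph V) (k : ℕ) (v : V) : Prop :=
  (∀ a b, Rel G v a → Rel G v b → Rel G a b) ∧ 2 * k < nsize G v

/-- Every solution contains the closed neighbourhood of a vertex satisfying `Big` as a cluster. -/
lemma Sol.rel_big {G H : SimpleGraph V} {k : ℕ} (hs : Sol G k H) {v a : V} (hv : Big G k v) :
    Rel H v a ↔ Rel G v a :=
  ⟨Rel.mono hs.le, fun h => hs.unsplit hv.2 hv.1 (Rel.refl _ _) h⟩

/-- The graph `G` without the edges that leave the closed neighbourhood of a vertex satisfying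
`Big`. -/
def cut (G : SimpleGraph V) (k : ℕ) : SimpleGraph V where
  Adj u w := G.Adj u w ∧ ∀ v, Big G k v → (Rel G v u ↔ Rel G v w)
  symm := ⟨fun _ _ h => ⟨h.1.symm, fun v hv => (h.2 v hv).symm⟩⟩
  loopless := ⟨fun _ h => h.1.ne rfl⟩

lemma cut_le (G : SimpleGraph V) (k : ℕ) : cut G k ≤ G := fun _ _ h => h.1

lemma Sol.le_cut {G H : SimpleGraph V} {k : ℕ} (hs : Sol G k H) : H ≤ cut G k := by
  intro u w h
  refine ⟨hs.le h, fun v hv => ?_⟩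
  rw [← hs.rel_big hv, ← hs.rel_big hv]
  exact ⟨fun h' => hs.cl _ _ _ h' (Or.inr h), fun h' => hs.cl _ _ _ h' (Or.inr h.symm)⟩

lemma cost_add {G G₀ H : SimpleGraph V} (h1 : H ≤ G₀) (h2 : G₀ ≤ G) :
    cost G H = cost G G₀ + cost G₀ H := by
  unfold cost
  rw [← cnt_or_eq]
  · refine cnt_congr fun p => ?_
    have := @h1 p.1 p.2
    have := @h2 p.1 p.2
    tauto
  · rintro p h h'
    exact h.2 h'.1

lemma sol_cut_iff {G H : SimpleGraph V} {k f : ℕ} (hf : cost G (cut G k) = 2 * f) :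
    Sol G k H ↔ f ≤ k ∧ Sol (cut G k) (k - f) H := by
  constructor
  · intro hs
    have := cost_add hs.le_cut (cut_le G k)
    have := hs.cost_le
    exact ⟨by omega, hs.le_cut, hs.cl, by omega⟩
  · rintro ⟨h, hs⟩
    have := cost_add hs.le (cut_le G k)
    have := hs.cost_le
    exact ⟨hs.le.trans (cut_le G k), hs.cl, by omega⟩

lemma yes_cut_iff {G : SimpleGraph V} {k η f : ℕ} (hf : cost G (cut G k) = 2 * f) :
    Yes G k η ↔ f ≤ k ∧ Yes (cut G k) (k - f) η := by
  simp only [Yes, sol_cut_iff hf, and_assoc, exists_and_left]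

/-- The connected component of `v` is a clique: all its vertices have the same closed
neighbourhood. -/
def Iso {V : Type*} (G : SimpleGraph V) (v : V) : Prop :=
  ∀ a, Rel G v a → ∀ b, Rel G v b ↔ Rel G a b

lemma Iso.of_rel {V : Type*} {G : SimpleGraph V} {v a : V} (h : Iso G v) (ha : Rel G v a) :
    Iso G a :=
  fun b hb c => (h a ha c).symm.trans (h b ((h a ha b).2 hb) c)

lemma Iso.nsize_eq {G : SimpleGraph V} {v a : V} (h : Iso G v) (ha : Rel G v a) :
    nsize G a = nsize G v := cnt_congr fun b => (h a ha b).symm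

lemma iso_congr {V : Type*} {G : SimpleGraph V} {v a : V} (ha : Rel G v a) : Iso G v ↔ Iso G a :=
  ⟨fun h => h.of_rel ha, fun h => h.of_rel ha.symm⟩

/-- In a solution, the clusters with more than `2 k` vertices are components of `cut G k`. -/
lemma Sol.iso_of_lt {G H : SimpleGraph V} {k : ℕ} (hs : Sol G k H) {v : V}
    (hv : 2 * k < nsize H v) : Iso (cut G k) v := by
  obtain ⟨x, hx, hu⟩ := exists_untouched hs.cost_le hv
  have hGH : ∀ a, Rel G x a ↔ Rel H v a := fun a =>
    ⟨fun h => hs.cl _ _ _ hx (hu a h), fun h => (hs.cl _ _ _ hx.symm h).mono hs.le⟩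
  have hbig : Big G k x := by
    refine ⟨fun a b ha hb => ?_, ?_⟩
    · exact (hs.cl _ _ _ ((hGH a).1 ha).symm ((hGH b).1 hb)).mono hs.le
    · rwa [nsize, cnt_congr hGH]
  -- no edge of `cut G k` leaves the closed neighbourhood of `x`, so this is a component
  have key : ∀ a, Rel H v a → ∀ b, Rel (cut G k) a b ↔ Rel H v b := by
    intro a ha b
    constructor
    · rintro (rfl | h)
      · exact ha
      · exact (hGH b).1 ((h.2 x hbig).1 ((hGH a).2 ha))
    · intro hb
      exact (hs.cl _ _ _ ha.symm hb).mono hs.le_cut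
  intro a ha b
  have ha' := (key v (Rel.refl _ _) a).1 ha
  rw [key v (Rel.refl _ _), key a ha']

/-- In a yes-instance, at most `(2 k) ^ 2` vertices lie in components of `cut G k` that are not
cliques: their clusters have at most `2 k` vertices, and each of these clusters meets one of the
at most `k` deleted edges. -/
lemma Sol.cnt_not_iso {G H : SimpleGraph V} {k : ℕ} (hs : Sol G k H) :
    cnt (fun v => ¬ Iso (cut G k) v) ≤ 2 * k * (2 * k) := by
  classical
  have hle := cost_add hs.le_cut (cut_le G k)
  have hc := hs.cost_le
  refine cnt_le_mul (((Finset.univ.filter fun p : V × V => (cut G k).Adj p.1 p.2 ∧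
    ¬ H.Adj p.1 p.2).image Prod.fst).filter fun x => nsize H x ≤ 2 * k) (fun x => Rel H x)
    ?_ ?_ ?_
  · refine (Finset.card_filter_le _ _).trans (Finset.card_image_le.trans ?_)
    rw [← cnt_eq_card]
    change cost _ _ ≤ _
    omega
  · intro x hx
    exact (Finset.mem_filter.1 hx).2
  · intro v hv
    -- a cluster without a deleted edge would be a clique component
    have hvx : ∃ x y, Rel H v x ∧ (cut G k).Adj x y ∧ ¬ H.Adj x y := by
      by_contra! hcon
      apply hv
      have key : ∀ a, Rel H v a → ∀ b, Rel (cut G k) a b ↔ Rel H v b := by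
        intro a ha b
        constructor
        · rintro (rfl | h)
          · exact ha
          · exact hs.cl _ _ _ ha (Or.inr (hcon a b ha h))
        · intro hb
          exact (hs.cl _ _ _ ha.symm hb).mono hs.le_cut
      intro a ha b
      have ha' := (key v (Rel.refl _ _) a).1 ha
      rw [key v (Rel.refl _ _), key a ha']
    obtain ⟨x, y, hx, h1, h2⟩ := hvx
    refine ⟨x, ?_, hx.symm⟩
    simp only [Finset.mem_filter, Finset.mem_image, Finset.mem_univ, true_and, Prod.exists,
      exists_and_right, exists_eq_right]
    refine ⟨⟨y, h1, h2⟩, ?_⟩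
    by_contra hlt
    exact hv ((iso_congr (hx.mono hs.le_cut)).2 (hs.iso_of_lt (not_le.1 hlt)))

end Forced

/-! ### The reduced graph -/

section Reduced

variable {V W : Type*} [Fintype V] [Fintype W]

/-- `v` lies in a component that is a clique with more than `2 k` vertices. -/
def Large (B : SimpleGraph V) (k : ℕ) (v : V) : Prop := Iso B v ∧ 2 * k < nsize B v

/-- `v` is the least vertex of a component that is a clique with at most `2 k` vertices. -/
def Lead [LinearOrder V] (B : SimpleGraph V) (k : ℕ) (v : V) : Prop :=
  (Iso B v ∧ nsize B v ≤ 2 * k) ∧ ∀ u, Rel B v u → v ≤ u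

/-- `v` is the least vertex of one of the first `2 k + 1` small clique components of its size. -/
def First [LinearOrder V] (B : SimpleGraph V) (k : ℕ) (v : V) : Prop :=
  Lead B k v ∧ rank (fun r => Lead B k r ∧ nsize B r = nsize B v) v < 2 * k + 1

/-- The vertices of the components that survive unchanged: those that are not cliques, and up to
`2 k + 1` small cliques of each size. -/
def Core [LinearOrder V] (B : SimpleGraph V) (k : ℕ) (v : V) : Prop :=
  ¬ Iso B v ∨ ∃ r, Rel B v r ∧ First B k r

/-- The vertices of the reduced graph: the core, and `2 k + 1` vertices from large cliques. -/
def Kept [LinearOrder V] (B : SimpleGraph V) (k : ℕ) (v : V) : Prop :=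
  Core B k v ∨ (Large B k v ∧ rank (Large B k) v < 2 * k + 1)

/-- All large cliques are merged into a single clique. -/
def merged (B : SimpleGraph V) (k : ℕ) : SimpleGraph V where
  Adj u w := (u ≠ w ∧ Large B k u ∧ Large B k w) ∨ B.Adj u w
  symm := ⟨fun _ _ h => h.imp (fun h => ⟨h.1.symm, h.2.2, h.2.1⟩) fun h => h.symm⟩
  loopless := ⟨fun _ h => h.elim (fun h => h.1 rfl) fun h => h.ne rfl⟩

lemma rel_merged {B : SimpleGraph V} {k : ℕ} {u w : V} :
    Rel (merged B k) u w ↔ (Large B k u ∧ Large B k w) ∨ Rel B u w := by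
  unfold Rel
  by_cases h : u = w <;> simp [merged, h]

variable {B H : SimpleGraph V} {k : ℕ}

lemma Large.of_rel {u v : V} (h : Large B k u) (hr : Rel B u v) : Large B k v :=
  ⟨h.1.of_rel hr, by rw [h.1.nsize_eq hr]; exact h.2⟩

lemma Core.of_rel [LinearOrder V] {u v : V} (h : Core B k u) (hr : Rel B u v) : Core B k v := by
  rcases h with h | ⟨r, h1, h2⟩
  · exact Or.inl fun h' => h ((iso_congr hr).2 h')
  · exact Or.inr ⟨r, (h2.1.1.1.of_rel h1.symm v hr r).1 h1, h2⟩

lemma Core.not_large [LinearOrder V] {v : V} (h : Core B k v) : ¬ Large B k v := by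
  rintro ⟨h1, h2⟩
  rcases h with h | ⟨r, h3, h4⟩
  · exact h h1
  · have := h1.nsize_eq h3
    have := h4.1.1.2
    omega

/-- A large clique component is a cluster of every solution. -/
lemma Sol.rel_large (hs : Sol B k H) {v a : V} (hv : Large B k v) : Rel H v a ↔ Rel B v a :=
  hs.rel_big ⟨fun a b ha hb => (hv.1 a ha b).1 hb, hv.2⟩

lemma Sol.nsize_large (hs : Sol B k H) {v : V} (hv : Large B k v) : nsize H v = nsize B v :=
  cnt_congr fun _ => hs.rel_large hv

lemma nsize_mono {G H : SimpleGraph V} (h : H ≤ G) (v : V) : nsize H v ≤ nsize G v :=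
  cnt_mono fun _ => Rel.mono h

lemma Sol.weaken {l : ℕ} (hs : Sol B l H) (h : l ≤ k) : Sol B k H :=
  ⟨hs.le, hs.cl, hs.cost_le.trans (by omega)⟩

/-- If a small clique is dropped, then each solution leaves some kept clique of the same size
untouched. -/
lemma exists_core_of_dropped [LinearOrder V] (hc : cost B H ≤ 2 * k) (hle : H ≤ B) {v : V}
    (hl : ¬ Large B k v) (hv : ¬ Core B k v) : ∃ r, Core B k r ∧ nsize H r = nsize B v := by
  classical
  have hiso : Iso B v := by
    by_contra h
    exact hv (Or.inl h)
  have hsm : nsize B v ≤ 2 * k := by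
    by_contra h
    exact hl ⟨hiso, not_le.1 h⟩
  obtain ⟨r, hr, hmin⟩ : ∃ r, Rel B v r ∧ ∀ u, Rel B v u → r ≤ u := by
    have hne : (Finset.univ.filter (Rel B v)).Nonempty := ⟨v, by simp [Rel.refl]⟩
    refine ⟨_, (Finset.mem_filter.1 (Finset.min'_mem _ hne)).2, fun u hu => ?_⟩
    exact Finset.min'_le _ _ (by simp [hu])
  have hrn : nsize B r = nsize B v := hiso.nsize_eq hr
  have hlead : Lead B k r :=
    ⟨⟨hiso.of_rel hr, by omega⟩, fun u hu => hmin u ((hiso r hr u).2 hu)⟩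
  set P : V → Prop := fun x => Lead B k x ∧ nsize B x = nsize B v with hP
  have hrank : 2 * k + 1 ≤ rank P r := by
    by_contra h
    refine hv (Or.inr ⟨r, hr, hlead, ?_⟩)
    rw [hrn]
    exact not_le.1 h
  have hlt : rank P r < cnt P := rank_lt_cnt ⟨hlead, hrn⟩
  have hcnt := cnt_rank_lt P (2 * k + 1)
  obtain ⟨x, ⟨hx, hxr⟩, hu⟩ := exists_untouched (P := fun v => P v ∧ rank P v < 2 * k + 1) hc
    (by omega)
  refine ⟨x, Or.inr ⟨x, Rel.refl _ _, hx.1, ?_⟩, ?_⟩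
  · rw [hx.2]
    exact hxr
  · rw [← hx.2]
    exact cnt_congr fun w => ⟨Rel.mono hle, hu w⟩

/-- The number of `i` with `P (e i)`, when `e` is injective and `P` holds on its range only. -/
lemma cnt_comp_eq {e : W → V} (he : Function.Injective e) {P : V → Prop} {Q : W → Prop}
    (h1 : ∀ i, Q i ↔ P (e i)) (h : ∀ v, P v → ∃ i, e i = v) : cnt Q = cnt P := by
  apply le_antisymm
  · exact cnt_le_of_inj e he fun i hi => (h1 i).1 hi
  · refine cnt_le_of_surj e fun v hv => ?_
    obtain ⟨i, rfl⟩ := h v hv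
    exact ⟨i, (h1 i).2 hv, rfl⟩

lemma rel_comap {V W : Type*} {G : SimpleGraph V} {e : W → V} (he : Function.Injective e)
    {i j : W} : Rel (G.comap e) i j ↔ Rel G (e i) (e j) := by
  unfold Rel
  rw [SimpleGraph.comap_adj, he.eq_iff]

variable [LinearOrder V] {l η d : ℕ} {e : W → V}

/-- If there is a large clique at all, then exactly `2 k + 1` vertices of large cliques are kept. -/
lemma cnt_kept_large (he : Function.Injective e) (hr : ∀ v, Kept B k v ↔ ∃ i, e i = v)
    {v : V} (hv : Large B k v) : cnt (fun i => Large B k (e i)) = 2 * k + 1 := by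
  have h1 : 2 * k + 1 ≤ cnt (Large B k) := hv.2.trans_le
    (cnt_mono fun _ h => hv.of_rel h)
  rw [← min_eq_left h1, ← cnt_rank_lt]
  refine cnt_comp_eq he (fun i => ⟨fun h => ⟨h, ?_⟩, And.left⟩)
    fun v hv => (hr v).1 (Or.inr hv)
  rcases (hr _).2 ⟨i, rfl⟩ with h' | h'
  · exact absurd h h'.not_large
  · exact h'.2

/-- A solution of the original graph restricts to the reduced graph; the difference of cluster
sizes that is allowed drops by the number `d` of vertices that the largest cluster loses. -/
lemma Yes.reduce (hl : l ≤ k) (hA : ∀ H v, Sol B l H → 2 * k < nsize H v → Iso B v)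
    (he : Function.Injective e) (hr : ∀ v, Kept B k v ↔ ∃ i, e i = v)
    (hd : d = 0 ∨ ∃ v, Large B k v ∧ nsize B v = 2 * k + 1 + d)
    (hy : Yes B l η) : Yes ((merged B k).comap e) l (η - d) := by
  obtain ⟨H, hs, hb⟩ := hy
  have hs' := hs.weaken hl
  have hsmall : ∀ v, ¬ Large B k v → nsize H v ≤ 2 * k := by
    intro v hv
    by_contra h
    exact hv ⟨hA H v hs (not_le.1 h), (not_le.1 h).trans_le (nsize_mono hs.le v)⟩
  -- the solution, after merging all large cliques into one cluster
  let H₁ : SimpleGraph V :=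
    { Adj := fun u w => (u ≠ w ∧ Large B k u ∧ Large B k w) ∨ H.Adj u w
      symm := ⟨fun _ _ h => h.imp (fun h => ⟨h.1.symm, h.2.2, h.2.1⟩) fun h => h.symm⟩
      loopless := ⟨fun _ h => h.elim (fun h => h.1 rfl) fun h => h.ne rfl⟩ }
  have hrel : ∀ u w, Rel H₁ u w ↔ (Large B k u ∧ Large B k w) ∨ Rel H u w := by
    intro u w
    unfold Rel
    by_cases h : u = w <;> simp [H₁, h]
  have hinv : ∀ {u w}, Rel H u w → Large B k u → Large B k w := fun h h' =>
    h'.of_rel (h.mono hs.le)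
  have hnon : ∀ i, ¬ Large B k (e i) → nsize (H₁.comap e) i = nsize H (e i) := by
    intro i hi
    refine cnt_comp_eq he (fun j => ?_) fun v hv => ?_
    · rw [rel_comap he, hrel]
      exact ⟨fun h => h.resolve_left fun h => hi h.1, Or.inr⟩
    · refine (hr v).1 (Or.inl ?_)
      rcases (hr _).2 ⟨i, rfl⟩ with h' | h'
      · exact h'.of_rel (hv.mono hs.le)
      · exact absurd h'.1 hi
  have hlar : ∀ i, Large B k (e i) → nsize (H₁.comap e) i = 2 * k + 1 := by
    intro i hi
    rw [← cnt_kept_large he hr hi]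
    refine cnt_congr fun j => ?_
    rw [rel_comap he, hrel]
    have := @hinv (e i) (e j)
    tauto
  refine ⟨H₁.comap e, ⟨?_, ?_, ?_⟩, ?_⟩
  · exact fun i j h => Or.imp_right (fun h => hs.le h) h
  · intro i j m h1 h2
    rw [rel_comap he, hrel] at h1 h2 ⊢
    rcases h1 with h1 | h1 <;> rcases h2 with h2 | h2
    · exact Or.inl ⟨h1.1, h2.2⟩
    · exact Or.inl ⟨h1.1, hinv h2 h1.2⟩
    · exact Or.inl ⟨hinv h1.symm h2.1, h2.2⟩
    · exact Or.inr (hs.cl _ _ _ h1 h2)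
  · refine le_trans (cnt_le_of_inj (Prod.map e e) (he.prodMap he) ?_) hs.cost_le
    rintro ⟨i, j⟩ ⟨h1, h2⟩
    exact ⟨(h1 : (merged B k).Adj _ _).resolve_left fun h => h2 (Or.inl h),
      fun h => h2 (Or.inr h)⟩
  · -- the largest clique occurs as a cluster of the given solution
    have hd' : d = 0 ∨ ∀ w, 2 * k + 1 + d ≤ nsize H w + η := by
      refine hd.imp_right ?_
      rintro ⟨v, hv, h⟩ w
      rw [← h, ← hs'.nsize_large hv]
      exact hb v w
    intro i j
    by_cases hi : Large B k (e i) <;> by_cases hj : Large B k (e j)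
    · rw [hlar i hi, hlar j hj]; omega
    · rw [hlar i hi, hnon j hj]
      have h1 := hb (e i) (e j)
      rw [hs'.nsize_large hi] at h1
      have := hi.2
      have := hsmall _ hj
      rcases hd' with h | h
      · omega
      · have := h (e j)
        omega
    · rw [hnon i hi, hlar j hj]
      have := hsmall _ hi
      omega
    · rw [hnon i hi, hnon j hj]
      have h1 := hb (e i) (e j)
      have := hsmall _ hi
      have := hsmall _ hj
      rcases hd' with h | h
      · omega
      · have := h (e j)
        omega

/-- A solution of the reduced graph extends to the original graph: all cliques that were dropped
or shrunk stay in one piece. -/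
lemma Yes.lift (hl : l ≤ k) (hA : ∀ H v, Sol B l H → 2 * k < nsize H v → Iso B v)
    (he : Function.Injective e) (hr : ∀ v, Kept B k v ↔ ∃ i, e i = v)
    (hd : ∀ v, Large B k v → nsize B v ≤ 2 * k + 1 + d)
    (hη : ∀ u v, Large B k u → Large B k v → nsize B u ≤ nsize B v + η)
    (hy : Yes ((merged B k).comap e) l (η - d)) : Yes B l η := by
  obtain ⟨H', hs', hb⟩ := hy
  have hcore : ∀ u, Core B k u → ∃ i, e i = u := fun u hu => (hr u).1 (Or.inl hu)
  have hsub : ∀ {i j}, Core B k (e i) → Rel H' i j → Rel B (e i) (e j) := by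
    intro i j hi h
    have h1 := h.mono hs'.le
    rw [rel_comap he, rel_merged] at h1
    exact h1.resolve_left fun h2 => hi.not_large h2.1
  -- delete the edges of the core that the given solution deletes, and no others
  let H : SimpleGraph V :=
    { Adj := fun u w => B.Adj u w ∧ (Core B k u → ∃ i j, e i = u ∧ e j = w ∧ H'.Adj i j)
      symm := ⟨fun u w h => ⟨h.1.symm, fun hw => by
        obtain ⟨i, j, h1, h2, h3⟩ := h.2 (hw.of_rel (Or.inr h.1.symm))
        exact ⟨j, i, h2, h1, h3.symm⟩⟩⟩
      loopless := ⟨fun _ h => h.1.ne rfl⟩ }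
  have hle : H ≤ B := fun _ _ h => h.1
  have hrelC : ∀ i w, Core B k (e i) → (Rel H (e i) w ↔ ∃ j, e j = w ∧ Rel H' i j) := by
    intro i w hi
    constructor
    · rintro (rfl | h)
      · exact ⟨i, rfl, Rel.refl _ _⟩
      · obtain ⟨i', j, h1, h2, h3⟩ := h.2 hi
        rw [he h1] at h3
        exact ⟨j, h2, Or.inr h3⟩
    · rintro ⟨j, rfl, h⟩
      have h1 := hsub hi h
      rcases h with rfl | h
      · exact Rel.refl _ _
      · rcases h1 with h1 | h1
        · exact Or.inl h1
        · exact Or.inr ⟨h1, fun _ => ⟨i, j, rfl, rfl, h⟩⟩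
  have hrelN : ∀ u w, ¬ Core B k u → (Rel H u w ↔ Rel B u w) := by
    intro u w hu
    exact or_congr_right ⟨fun h => h.1, fun h => ⟨h, fun h' => absurd h' hu⟩⟩
  have hcl : Cl H := by
    intro u v w h1 h2
    by_cases hu : Core B k u
    · have hv := hu.of_rel (h1.mono hle)
      obtain ⟨i, rfl⟩ := hcore u hu
      obtain ⟨j, rfl, h3⟩ := (hrelC _ _ hu).1 h1
      obtain ⟨m, rfl, h4⟩ := (hrelC _ _ hv).1 h2
      exact (hrelC _ _ hu).2 ⟨m, rfl, hs'.cl _ _ _ h3 h4⟩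
    · have hv : ¬ Core B k v := fun hv => hu (hv.of_rel (h1.mono hle).symm)
      rw [hrelN _ _ hu] at h1 ⊢
      rw [hrelN _ _ hv] at h2
      have hiso : Iso B u := by
        by_contra h
        exact hu (Or.inl h)
      exact (hiso v h1 w).2 h2
  have hcost : cost B H ≤ 2 * l := by
    refine le_trans (cnt_le_of_surj (Prod.map e e) ?_) hs'.cost_le
    rintro ⟨u, w⟩ ⟨h1, h2⟩
    have hu : Core B k u := by
      by_contra hu
      exact h2 ⟨h1, fun h => absurd h hu⟩
    obtain ⟨i, rfl⟩ := hcore u hu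
    obtain ⟨j, rfl⟩ := hcore w (hu.of_rel (Or.inr h1))
    exact ⟨(i, j), ⟨Or.inr h1, fun h => h2 ⟨h1, fun _ => ⟨i, j, rfl, rfl, h⟩⟩⟩, rfl⟩
  have hs : Sol B l H := ⟨hle, hcl, hcost⟩
  have hnC : ∀ i, Core B k (e i) → nsize H (e i) = nsize H' i := by
    intro i hi
    refine (cnt_comp_eq he (fun j => ?_) fun v hv => ?_).symm
    · rw [hrelC _ _ hi]
      exact ⟨fun h => ⟨j, rfl, h⟩, fun ⟨j', h1, h2⟩ => he h1 ▸ h2⟩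
    · obtain ⟨j, h, -⟩ := (hrelC _ _ hi).1 hv
      exact ⟨j, h⟩
  have hnN : ∀ u, ¬ Core B k u → nsize H u = nsize B u := fun u hu =>
    cnt_congr fun w => hrelN u w hu
  have hsmall : ∀ v, ¬ Large B k v → nsize H v ≤ 2 * k := by
    intro v hv
    by_contra h
    exact hv ⟨hA H v hs (not_le.1 h), (not_le.1 h).trans_le (nsize_mono hs.le v)⟩
  have hrep : ∀ v, ¬ Large B k v → ∃ i, nsize H v = nsize H' i := by
    intro v hv
    by_cases hc : Core B k v
    · obtain ⟨i, rfl⟩ := hcore v hc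
      exact ⟨i, hnC i hc⟩
    · obtain ⟨r, h1, h2⟩ := exists_core_of_dropped (hs.weaken hl).cost_le hle hv hc
      obtain ⟨i, rfl⟩ := hcore r h1
      exact ⟨i, by rw [hnN v hc, ← h2, hnC i h1]⟩
  have hlar : ∀ v, Large B k v → nsize H v = nsize B v := fun v hv =>
    hnN v fun h => h.not_large hv
  refine ⟨H, hs, fun u w => ?_⟩
  by_cases hu : Large B k u <;> by_cases hw : Large B k w
  · rw [hlar u hu, hlar w hw]
    exact hη u w hu hw
  · obtain ⟨j, hj⟩ := hrep w hw
    have hc := cnt_kept_large he hr hu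
    obtain ⟨i₀, hi₀⟩ : ∃ i, Large B k (e i) := by
      by_contra! hcon
      rw [cnt_congr (Q := fun _ => False) fun i => iff_of_false (hcon i) not_false] at hc
      simp [cnt] at hc
    -- the merged clique has more than `2 k` vertices and hence is not split
    have h1 : 2 * k + 1 ≤ nsize H' i₀ := by
      rw [← hc]
      refine cnt_mono fun i hi => (hs'.weaken hl).unsplit (P := fun i => Large B k (e i)) ?_ ?_
        hi₀ hi
      · omega
      · intro a b ha hb
        rw [rel_comap he, rel_merged]
        exact Or.inl ⟨ha, hb⟩
    have h2 := hb i₀ j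
    have h3 := hsmall w hw
    have h4 := hd u hu
    rw [hlar u hu]
    omega
  · rw [hlar w hw]
    have := hsmall u hu
    have := hw.2
    omega
  · obtain ⟨i, hi⟩ := hrep u hu
    obtain ⟨j, hj⟩ := hrep w hw
    have := hb i j
    omega

/-- The core has `O(k ^ 2)` vertices in components that are not cliques, and `2 k + 1` cliques of
each of the sizes up to `2 k`. -/
lemma cnt_kept_le (hB : cnt (fun v => ¬ Iso B v) ≤ 2 * k * (2 * k)) :
    cnt (Kept B k) ≤ 25 * (k ^ 4 + 1) := by
  classical
  have h1 : cnt (fun v => ∃ r, Rel B v r ∧ First B k r) ≤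
      (2 * k + 1) * ((2 * k + 1) * (2 * k)) := by
    refine cnt_le_mul (Finset.range (2 * k + 1))
      (fun s v => ∃ r, Rel B v r ∧ First B k r ∧ nsize B r = s) (by simp) (fun s _ => ?_) ?_
    · refine cnt_le_mul (Finset.univ.filter fun r => (Lead B k r ∧ nsize B r = s) ∧
        rank (fun r => Lead B k r ∧ nsize B r = s) r < 2 * k + 1) (fun r v => Rel B r v) ?_ ?_ ?_
      · rw [← cnt_eq_card, cnt_rank_lt]
        exact min_le_left _ _
      · intro r hr
        exact (Finset.mem_filter.1 hr).2.1.1.1.2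
      · rintro v ⟨r, h1, h2, rfl⟩
        exact ⟨r, Finset.mem_filter.2 ⟨Finset.mem_univ r, ⟨h2.1, rfl⟩, h2.2⟩, h1.symm⟩
    · rintro v ⟨r, h1, h2⟩
      exact ⟨_, Finset.mem_range.2 (Nat.lt_succ_of_le h2.1.1.2), r, h1, h2, rfl⟩
  have h2 : cnt (fun v => Large B k v ∧ rank (Large B k) v < 2 * k + 1) ≤ 2 * k + 1 := by
    rw [cnt_rank_lt]
    exact min_le_left _ _
  have h3 : cnt (Kept B k) ≤ _ := cnt_or_le (Core B k) _
  have h4 : cnt (Core B k) ≤ _ := cnt_or_le (fun v => ¬ Iso B v) _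
  have h5 : k ^ 1 ≤ k ^ 4 + 1 := by
    rcases Nat.eq_zero_or_pos k with rfl | h
    · simp
    · exact (Nat.pow_le_pow_right h (by norm_num)).trans (Nat.le_succ _)
  have h6 : k ^ 2 ≤ k ^ 4 + 1 := by
    rcases Nat.eq_zero_or_pos k with rfl | h
    · simp
    · exact (Nat.pow_le_pow_right h (by norm_num)).trans (Nat.le_succ _)
  have h7 : k ^ 3 ≤ k ^ 4 + 1 := by
    rcases Nat.eq_zero_or_pos k with rfl | h
    · simp
    · exact (Nat.pow_le_pow_right h (by norm_num)).trans (Nat.le_succ _)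
  nlinarith

end Reduced

/-! ### The kernel -/

/-- A trivial no-instance: a path on three vertices, no deletion being allowed. -/
def noInstance : Instance where
  n := 3
  G := { Adj := fun u v => u ≠ v ∧ (u = 1 ∨ v = 1)
         symm := ⟨fun _ _ h => ⟨h.1.symm, h.2.symm⟩⟩
         loopless := ⟨fun _ h => h.1 rfl⟩ }
  k := 0
  η := 0

lemma noInstance_not_isYes : ¬ noInstance.IsYes := by
  rw [isYes_iff]
  rintro ⟨H, ⟨hle, hcl, hc⟩, -⟩
  have hH : ∀ u v, noInstance.G.Adj u v → H.Adj u v := by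
    intro u v h
    by_contra h'
    have : 0 < cost noInstance.G H :=
      cnt_pos_of (P := fun p : _ × _ => noInstance.G.Adj p.1 p.2 ∧ ¬ H.Adj p.1 p.2)
        (v := (u, v)) ⟨h, h'⟩
    change _ ≤ 2 * 0 at hc
    omega
  have h1 : Rel H (0 : Fin 3) (1 : Fin 3) := Or.inr (hH _ _ ⟨by decide, Or.inr rfl⟩)
  have h2 : Rel H (1 : Fin 3) (2 : Fin 3) := Or.inr (hH _ _ ⟨by decide, Or.inl rfl⟩)
  rcases (hcl _ _ _ h1 h2).mono hle with h | h
  · exact absurd h (by decide : (0 : Fin 3) ≠ 2)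
  · exact absurd h.2 (by decide : ¬ ((0 : Fin 3) = 1 ∨ (2 : Fin 3) = 1))

namespace Instance

/-- The graph of the instance without the edges that leave forced clusters. -/
def base (I : Instance) : SimpleGraph (Fin I.n) := cut I.G I.k

/-- The number of edges that leave forced clusters. -/
noncomputable def forced (I : Instance) : ℕ :=
  ∑ u, cnt fun v => u < v ∧ I.G.Adj u v ∧ ¬ I.base.Adj u v

/-- The number of vertices by which the largest clique component exceeds `2 k + 1`. -/
noncomputable def excess (I : Instance) : ℕ :=
  cnt fun i : Fin I.n => ∃ v, Large I.base I.k v ∧ 2 * I.k + 1 + i < nsize I.base v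

/-- Instances that are recognized as no-instances: there are too many forced deletions, too many
vertices outside clique components, or two large cliques whose sizes differ too much. -/
def Bad (I : Instance) : Prop :=
  I.k < I.forced ∨ 2 * I.k * (2 * I.k) < cnt (fun v => ¬ Iso I.base v) ∨
    ∃ u v, Large I.base I.k u ∧ Large I.base I.k v ∧ nsize I.base v + I.η < nsize I.base u

/-- The number of vertices of the reduced graph. -/
noncomputable def keptNum (I : Instance) : ℕ := cnt (Kept I.base I.k)

open Classical in
/-- The increasing enumeration of the vertices of the reduced graph. -/
noncomputable def enum (I : Instance) : Fin I.keptNum ↪o Fin I.n :=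
  (Finset.univ.filter (Kept I.base I.k)).orderEmbOfFin (cnt_eq_card _).symm

lemma kept_iff (I : Instance) (v : Fin I.n) : Kept I.base I.k v ↔ ∃ i, I.enum i = v := by
  classical
  have := Set.ext_iff.1 (Finset.range_orderEmbOfFin (Finset.univ.filter (Kept I.base I.k))
    (cnt_eq_card _).symm) v
  simp only [Set.mem_range, Finset.coe_filter, Finset.mem_univ, true_and,
    Set.mem_ofPred_eq] at this
  exact this.symm

/-- The instance produced when no obstruction is found. -/
noncomputable def reduced (I : Instance) : Instance where
  n := I.keptNum
  G := (merged I.base I.k).comap I.enum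
  k := I.k - I.forced
  η := min (I.η - I.excess) I.keptNum

open Classical in
/-- The kernel. -/
noncomputable def kernel (I : Instance) : Instance := if I.Bad then noInstance else I.reduced

lemma cost_base (I : Instance) : cost I.G I.base = 2 * I.forced := cost_eq_two_mul _ _

lemma nsize_le_excess (I : Instance) (v : Fin I.n) (hv : Large I.base I.k v) :
    nsize I.base v ≤ 2 * I.k + 1 + I.excess := by
  have hn : nsize I.base v ≤ I.n := (cnt_le_card _).trans (Fintype.card_fin _).le
  by_contra! h
  -- otherwise the numbers `0, …, I.excess` would all be counted by `I.excess`
  have h2 : cnt (fun i : Fin (I.excess + 1) => True) ≤ I.excess := by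
    refine cnt_le_of_inj (fun i => ⟨i, by omega⟩ : Fin (I.excess + 1) → Fin I.n) ?_ ?_
    · intro i j h
      simpa [Fin.ext_iff] using h
    · intro i _
      exact ⟨v, hv, by have := i.2; simp only; omega⟩
  simp [cnt] at h2

lemma excess_eq (I : Instance) : I.excess = 0 ∨
    ∃ v, Large I.base I.k v ∧ nsize I.base v = 2 * I.k + 1 + I.excess := by
  classical
  by_cases h : (Finset.univ.filter (Large I.base I.k)).Nonempty
  · obtain ⟨v, hv, hmax⟩ := Finset.exists_max_image _ (nsize I.base) h
    simp only [Finset.mem_filter, Finset.mem_univ, true_and] at hv hmax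
    have h1 := I.nsize_le_excess v hv
    have h2 : I.excess ≤ nsize I.base v - (2 * I.k + 1) := by
      have : I.excess ≤ cnt (fun i : Fin (nsize I.base v - (2 * I.k + 1)) => True) := by
        have hpos : ∀ i : Fin I.n, (∃ v, Large I.base I.k v ∧ 2 * I.k + 1 + i < nsize I.base v) →
            (i : ℕ) < nsize I.base v - (2 * I.k + 1) := by
          rintro i ⟨w, hw, hi⟩
          have := hmax w hw
          omega
        have hn : nsize I.base v ≤ I.n := (cnt_le_card _).trans (Fintype.card_fin _).le
        refine cnt_le_of_surj (fun i => ⟨i, by omega⟩) fun i hi => ?_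
        exact ⟨⟨i, hpos i hi⟩, trivial, rfl⟩
      simpa [cnt] using this
    have := hv.2
    exact Or.inr ⟨v, hv, by omega⟩
  · left
    simp only [Finset.not_nonempty_iff_eq_empty, Finset.filter_eq_empty_iff, Finset.mem_univ,
      true_imp_iff] at h
    rw [excess, cnt_congr (Q := fun _ => False)]
    · simp [cnt]
    · rintro i
      simp only [iff_false, not_exists, not_and]
      intro v hv
      exact absurd hv (h (x := v))

lemma not_isYes_of_bad (I : Instance) (h : I.Bad) : ¬ I.IsYes := by
  rw [isYes_iff]
  rintro ⟨H, hs, hb⟩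
  have hs1 := (sol_cut_iff I.cost_base).1 hs
  rcases h with h | h | ⟨u, v, hu, hv, h⟩
  · omega
  · have := hs.cnt_not_iso
    change cnt (fun v => ¬ Iso I.base v) ≤ _ at this
    omega
  · have hs2 : Sol I.base I.k H := hs1.2.weaken (Nat.sub_le _ _)
    have := hb u v
    rw [hs2.nsize_large hu, hs2.nsize_large hv] at this
    omega

lemma kernel_isYes (I : Instance) : I.kernel.IsYes ↔ I.IsYes := by
  unfold kernel
  split_ifs with h
  · exact iff_of_false noInstance_not_isYes (I.not_isYes_of_bad h)
  · rw [isYes_iff, isYes_iff I, yes_cut_iff I.cost_base]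
    simp only [Bad, not_or, not_lt, not_exists, not_and] at h
    have hA : ∀ H v, Sol I.base (I.k - I.forced) H → 2 * I.k < nsize H v → Iso I.base v :=
      fun H v hs hv => ((sol_cut_iff I.cost_base).2 ⟨h.1, hs⟩).iso_of_lt hv
    change Yes ((merged I.base I.k).comap I.enum) (I.k - I.forced)
      (min (I.η - I.excess) I.keptNum) ↔ _
    rw [yes_min_card _ _ _ _ (Fintype.card_fin _).le]
    exact ⟨fun hy => ⟨h.1, hy.lift (Nat.sub_le _ _) hA I.enum.injective I.kept_iff
      I.nsize_le_excess fun u v hu hv => h.2.2 u v hu hv⟩,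
      fun hy => hy.2.reduce (Nat.sub_le _ _) hA I.enum.injective I.kept_iff I.excess_eq⟩

lemma kernel_n_le (I : Instance) : I.kernel.n ≤ 25 * (I.k ^ 4 + 1) := by
  unfold kernel
  split_ifs with h
  · change 3 ≤ _
    omega
  · simp only [Bad, not_or, not_lt] at h
    exact cnt_kept_le h.2.1

lemma kernel_k_le (I : Instance) : I.kernel.k ≤ I.k := by
  unfold kernel
  split_ifs with h
  · exact Nat.zero_le _
  · exact Nat.sub_le _ _

lemma kernel_η_le (I : Instance) : I.kernel.η ≤ I.kernel.n := by
  unfold kernel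
  split_ifs with h
  · exact Nat.zero_le _
  · exact min_le_right _ _

end Instance

/-- A computable bound for the size of the kernel. -/
def sizeBound (k : ℕ) : ℕ :=
  25 * (k * k * (k * k) + 1) * (25 * (k * k * (k * k) + 1)) + k + 25 * (k * k * (k * k) + 1) + k

lemma computable_sizeBound : Computable sizeBound := by
  apply Primrec.to_comp
  have hk : Primrec fun k : ℕ => k := Primrec.id
  have h2 := Primrec.nat_mul.comp hk hk
  have h4 := Primrec.nat_mul.comp h2 h2
  have h5 := Primrec.nat_mul.comp (Primrec.const 25) (Primrec.nat_add.comp h4 (Primrec.const 1))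
  exact Primrec.nat_add.comp (Primrec.nat_add.comp (Primrec.nat_add.comp
    (Primrec.nat_mul.comp h5 h5) hk) h5) hk

lemma size_kernel_le (I : Instance) : I.kernel.size + I.kernel.k ≤ sizeBound I.k := by
  have h1 := I.kernel_n_le
  have h2 := I.kernel_k_le
  have h3 := I.kernel_η_le
  have hs : ∀ m, Nat.size m ≤ m := fun m => Nat.size_le.2 Nat.lt_two_pow_self
  have h4 := hs I.kernel.k
  have h5 := hs I.kernel.η
  rw [show I.k ^ 4 = I.k * I.k * (I.k * I.k) by ring] at h1
  have h6 := Nat.mul_le_mul h1 h1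
  unfold Instance.size sizeBound
  rw [sq]
  omega

/-! ### Expressions with bounded sums -/

/-- `Runs p T M Q`: started with memory `M`, the program `p` halts after at most `T` steps with a
memory that satisfies `Q`. -/
def Runs (p : Program) (T : ℕ) (M : Memory) (Q : Memory → Prop) : Prop :=
  ∃ t M', Exec p M t M' ∧ t ≤ T ∧ Q M'

lemma Runs.mono {p : Program} {S T : ℕ} {M : Memory} {Q R : Memory → Prop} (h : Runs p S M Q)
    (hT : S ≤ T) (hQ : ∀ M', Q M' → R M') : Runs p T M R := by
  obtain ⟨t, M', h1, h2, h3⟩ := h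
  exact ⟨t, M', h1, h2.trans hT, hQ _ h3⟩

lemma Runs.seq {p q : Program} {S T : ℕ} {M : Memory} {Q R : Memory → Prop} (hp : Runs p S M Q)
    (hq : ∀ M', Q M' → Runs q T M' R) : Runs (.seq p q) (S + T) M R := by
  obtain ⟨s, M', h1, h2, h3⟩ := hp
  obtain ⟨t, M'', h4, h5, h6⟩ := hq M' h3
  exact ⟨s + t, M'', .seq h1 h4, Nat.add_le_add h2 h5, h6⟩

lemma Runs.store {a : ℕ} {e f : Expr} {M : Memory} {T : ℕ} {Q : Memory → Prop}
    (hT : e.cost + f.cost + 1 ≤ T)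
    (hQ : Q (Function.update M a (Function.update (M a) (e.eval M) (f.eval M)))) :
    Runs (.store a e f) T M Q := ⟨_, _, .store a e f M, hT, hQ⟩

/-- The content of cell `0` of an array that serves as a register. -/
abbrev reg (a : ℕ) : Expr := .cell a (.lit 0)

/-- A loop that runs until the counter in register `c` reaches the number in register `0`. -/
def forLoop (c : ℕ) (p : Program) : Program := .loop (.sub (reg 0) (reg c)) p

/-- A loop whose body increments the counter is verified by an invariant that depends on the
counter. -/
lemma Runs.forLoop {c n T : ℕ} {p : Program} (Inv : ℕ → Memory → Prop)
    (hreg : ∀ i M, Inv i M → M 0 0 = n ∧ M c 0 = i)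
    (hp : ∀ i < n, ∀ M, Inv i M → Runs p T M (Inv (i + 1))) {M : Memory} (hM : Inv 0 M) :
    Runs (forLoop c p) (n * (T + 6) + 6) M (Inv n) := by
  have key : ∀ m i M, i + m = n → Inv i M →
      Runs (BCD.forLoop c p) (m * (T + 6) + 6) M (Inv n) := by
    intro m
    induction m with
    | zero =>
      intro i M hi h
      obtain ⟨h1, h2⟩ := hreg i M h
      refine ⟨_, M, Exec.loop_stop ?_, ?_, ?_⟩
      · simp only [Expr.eval, h1, h2]; omega
      · simp [Expr.cost]
      · rwa [show n = i by omega]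
    | succ m ih =>
      intro i M hi h
      obtain ⟨h1, h2⟩ := hreg i M h
      obtain ⟨s, M', h3, h4, h5⟩ := hp i (by omega) M h
      obtain ⟨t, M'', h6, h7, h8⟩ := ih (i + 1) M' (by omega) h5
      refine ⟨_, M'', .loop_step ?_ h3 h6, ?_, h8⟩
      · simp only [Expr.eval, h1, h2]; omega
      · simp only [Expr.cost]
        have : (m + 1) * (T + 6) = m * (T + 6) + (T + 6) := by ring
        omega
  exact key n 0 M (by omega) hM

/-- Expressions with variables, conditionals, and sums over all numbers below the content of
register `0`. -/
inductive Ex where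
  | lit (c : ℕ)
  | var (v : ℕ)
  | cell (a : ℕ) (x : Ex)
  | add (x y : Ex)
  | sub (x y : Ex)
  | ite (c x y : Ex)
  | sum (v : ℕ) (x : Ex)

namespace Ex

/-- The value of an expression; `ρ` gives the values of the variables. -/
def eval (M : Memory) : (ℕ → ℕ) → Ex → ℕ
  | _, lit c => c
  | ρ, var v => ρ v
  | ρ, cell a x => M a (x.eval M ρ)
  | ρ, add x y => x.eval M ρ + y.eval M ρ
  | ρ, sub x y => x.eval M ρ - y.eval M ρ
  | ρ, ite c x y => if c.eval M ρ ≠ 0 then x.eval M ρ else y.eval M ρ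
  | ρ, sum v x => ∑ i ∈ Finset.range (M 0 0), x.eval M (Function.update ρ v i)

/-- All arrays that are needed to evaluate the expression satisfy `p`. -/
def reads (p : ℕ → Bool) : Ex → Bool
  | lit _ => true
  | var _ => true
  | cell a x => p a && x.reads p
  | add x y => x.reads p && y.reads p
  | sub x y => x.reads p && y.reads p
  | ite c x y => c.reads p && x.reads p && y.reads p
  | sum _ x => p 0 && x.reads p

lemma reads_mono {p q : ℕ → Bool} (h : ∀ a, p a = true → q a = true) (x : Ex)
    (hx : x.reads p = true) : x.reads q = true := by
  induction x with
  | lit c => rfl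
  | var v => rfl
  | cell a x ih => simp only [reads, Bool.and_eq_true] at hx ⊢; exact ⟨h _ hx.1, ih hx.2⟩
  | add x y ihx ihy => simp only [reads, Bool.and_eq_true] at hx ⊢; exact ⟨ihx hx.1, ihy hx.2⟩
  | sub x y ihx ihy => simp only [reads, Bool.and_eq_true] at hx ⊢; exact ⟨ihx hx.1, ihy hx.2⟩
  | ite c x y ihc ihx ihy =>
    simp only [reads, Bool.and_eq_true] at hx ⊢; exact ⟨⟨ihc hx.1.1, ihx hx.1.2⟩, ihy hx.2⟩
  | sum v x ih => simp only [reads, Bool.and_eq_true] at hx ⊢; exact ⟨h _ hx.1, ih hx.2⟩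

lemma eval_congr {p : ℕ → Bool} {M M' : Memory} (h : ∀ a, p a = true → M a = M' a) (x : Ex)
    (hx : x.reads p = true) (ρ : ℕ → ℕ) : x.eval M ρ = x.eval M' ρ := by
  induction x generalizing ρ with
  | lit c => rfl
  | var v => rfl
  | cell a x ih =>
    simp only [reads, Bool.and_eq_true] at hx
    simp only [eval, ih hx.2, h _ hx.1]
  | add x y ihx ihy =>
    simp only [reads, Bool.and_eq_true] at hx
    simp only [eval, ihx hx.1, ihy hx.2]
  | sub x y ihx ihy =>
    simp only [reads, Bool.and_eq_true] at hx
    simp only [eval, ihx hx.1, ihy hx.2]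
  | ite c x y ihc ihx ihy =>
    simp only [reads, Bool.and_eq_true] at hx
    simp only [eval, ihc hx.1.1, ihx hx.1.2, ihy hx.2]
  | sum v x ih =>
    simp only [reads, Bool.and_eq_true] at hx
    simp only [eval, ih hx.2, h _ hx.1]

/-- A program that evaluates an expression. The variable `v` is kept in register `σ v`; the result
is left in register `d`, and only the arrays from `d` on are used as scratch space. -/
def comp : Ex → (ℕ → ℕ) → ℕ → Program
  | lit c, _, d => .store d (.lit 0) (.lit c)
  | var v, σ, d => .store d (.lit 0) (reg (σ v))
  | cell a x, σ, d => .seq (x.comp σ d) (.store d (.lit 0) (.cell a (reg d)))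
  | add x y, σ, d => .seq (x.comp σ d) (.seq (y.comp σ (d + 1))
      (.store d (.lit 0) (.add (reg d) (reg (d + 1)))))
  | sub x y, σ, d => .seq (x.comp σ d) (.seq (y.comp σ (d + 1))
      (.store d (.lit 0) (.sub (reg d) (reg (d + 1)))))
  | ite c x y, σ, d => .seq (c.comp σ d) (.ite (reg d) (x.comp σ d) (y.comp σ d))
  | sum v x, σ, d => .seq (.store d (.lit 0) (.lit 0)) (.seq (.store (d + 1) (.lit 0) (.lit 0))
      (forLoop (d + 1) (.seq (x.comp (Function.update σ v (d + 1)) (d + 2))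
        (.seq (.store d (.lit 0) (.add (reg d) (reg (d + 2))))
          (.store (d + 1) (.lit 0) (.add (reg (d + 1)) (.lit 1)))))))

/-- A bound for the running time of `Ex.comp`, as a polynomial in the content of register `0`. -/
noncomputable def time : Ex → Polynomial ℕ
  | lit _ => 4
  | var _ => 4
  | cell _ x => x.time + 5
  | add x y => x.time + (y.time + 7)
  | sub x y => x.time + (y.time + 7)
  | ite c x y => c.time + (x.time + y.time + 3)
  | sum _ x => 3 + (3 + (Polynomial.X * ((x.time + (7 + 6)) + 6) + 6))

/-- The memory after writing `n` into register `a`. -/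
abbrev setReg (M : Memory) (a n : ℕ) : Memory := Function.update M a (Function.update (M a) 0 n)

/-- The program for an expression is correct, runs in the stated time, and does not change the
arrays below `d`. -/
lemma comp_runs (x : Ex) : ∀ (σ : ℕ → ℕ) (d : ℕ), (∀ v, σ v < d) →
    x.reads (fun a => decide (a < d)) = true → 0 < d → ∀ M : Memory,
    Runs (x.comp σ d) (x.time.eval (M 0 0)) M fun M' =>
      M' d 0 = x.eval M (fun v => M (σ v) 0) ∧ ∀ a < d, M' a = M a := by
  have lift : ∀ (x : Ex) (d e : ℕ), d ≤ e → x.reads (fun a => decide (a < d)) = true →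
      x.reads (fun a => decide (a < e)) = true := fun x d e hde =>
    reads_mono (fun a h => by simp only [decide_eq_true_eq] at h ⊢; omega) x
  induction x with
  | lit c =>
    intro σ d _ _ _ M
    refine Runs.store (by simp [time, Expr.cost]) ⟨by simp [Expr.eval, eval], fun a ha => ?_⟩
    exact Function.update_of_ne (by omega) _ _
  | var v =>
    intro σ d _ _ _ M
    refine Runs.store (by simp [time, Expr.cost]) ⟨by simp [Expr.eval, eval], fun a ha => ?_⟩
    exact Function.update_of_ne (by omega) _ _
  | cell b x ih =>
    intro σ d hσ hx hd M
    simp only [reads, Bool.and_eq_true, decide_eq_true_eq] at hx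
    simp only [time, Polynomial.eval_add]
    refine (ih σ d hσ hx.2 hd M).seq fun M' hM' => ?_
    refine Runs.store (by simp [Expr.cost]) ⟨?_, fun a ha => ?_⟩
    · simp [Expr.eval, eval, hM'.1, hM'.2 b hx.1]
    · rw [Function.update_of_ne (by omega), hM'.2 a ha]
  | add x y ihx ihy =>
    intro σ d hσ hx hd M
    simp only [reads, Bool.and_eq_true] at hx
    simp only [time, Polynomial.eval_add]
    refine (ihx σ d hσ hx.1 hd M).seq fun M' hM' => ?_
    have h0 := hM'.2 0 hd
    rw [← h0]
    refine (ihy σ (d + 1) (fun v => (hσ v).trans (Nat.lt_succ_self d))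
      (lift _ _ _ (Nat.le_succ d) hx.2) (Nat.succ_pos d) M').seq fun M'' hM'' => ?_
    refine Runs.store (by simp [Expr.cost]) ⟨?_, fun a ha => ?_⟩
    · simp only [Expr.eval, eval, Function.update_self, hM''.1, hM''.2 d (Nat.lt_succ_self d),
        hM'.1]
      rw [eval_congr (M := M) (M' := M') (fun a ha => (hM'.2 a (by simpa using ha)).symm) y hx.2]
      simp only [hM'.2 _ (hσ _)]
    · rw [Function.update_of_ne (by omega), hM''.2 a (by omega), hM'.2 a ha]
  | sub x y ihx ihy =>
    intro σ d hσ hx hd M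
    simp only [reads, Bool.and_eq_true] at hx
    simp only [time, Polynomial.eval_add]
    refine (ihx σ d hσ hx.1 hd M).seq fun M' hM' => ?_
    have h0 := hM'.2 0 hd
    rw [← h0]
    refine (ihy σ (d + 1) (fun v => (hσ v).trans (Nat.lt_succ_self d))
      (lift _ _ _ (Nat.le_succ d) hx.2) (Nat.succ_pos d) M').seq fun M'' hM'' => ?_
    refine Runs.store (by simp [Expr.cost]) ⟨?_, fun a ha => ?_⟩
    · simp only [Expr.eval, eval, Function.update_self, hM''.1, hM''.2 d (Nat.lt_succ_self d),
        hM'.1]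
      rw [eval_congr (M := M) (M' := M') (fun a ha => (hM'.2 a (by simpa using ha)).symm) y hx.2]
      simp only [hM'.2 _ (hσ _)]
    · rw [Function.update_of_ne (by omega), hM''.2 a (by omega), hM'.2 a ha]
  | ite c x y ihc ihx ihy =>
    intro σ d hσ hx hd M
    simp only [reads, Bool.and_eq_true] at hx
    simp only [time, Polynomial.eval_add]
    refine (ihc σ d hσ hx.1.1 hd M).seq fun M' hM' => ?_
    have h0 := hM'.2 0 hd
    have hev : ∀ z : Ex, z.reads (fun a => decide (a < d)) = true →
        z.eval M' (fun v => M' (σ v) 0) = z.eval M (fun v => M (σ v) 0) := by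
      intro z hz
      rw [eval_congr (M := M') (M' := M) (fun a ha => hM'.2 a (by simpa using ha)) z hz]
      simp only [hM'.2 _ (hσ _)]
    by_cases hc : c.eval M (fun v => M (σ v) 0) = 0
    · obtain ⟨t, M'', h1, h2, h3, h4⟩ := ihy σ d hσ hx.2 hd M'
      refine ⟨_, M'', .ite_false ?_ h1, ?_, ?_, fun a ha => ?_⟩
      · simpa [Expr.eval, hM'.1] using hc
      · rw [h0] at h2
        simp [Expr.cost]
        omega
      · rw [h3, hev y hx.2]
        simp [eval, hc]
      · rw [h4 a ha, hM'.2 a ha]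
    · obtain ⟨t, M'', h1, h2, h3, h4⟩ := ihx σ d hσ hx.1.2 hd M'
      refine ⟨_, M'', .ite_true ?_ h1, ?_, ?_, fun a ha => ?_⟩
      · simpa [Expr.eval, hM'.1] using hc
      · rw [h0] at h2
        simp [Expr.cost]
        omega
      · rw [h3, hev x hx.1.2]
        simp [eval, hc]
      · rw [h4 a ha, hM'.2 a ha]
  | sum v x ih =>
    intro σ d hσ hx hd M
    simp only [reads, Bool.and_eq_true] at hx
    simp only [time, Polynomial.eval_add, Polynomial.eval_mul, Polynomial.eval_X]
    set n := M 0 0 with hn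
    have start : Runs (.store d (.lit 0) (.lit 0)) (Polynomial.eval n 3) M fun M' =>
        M' = setReg M d 0 := Runs.store (by simp [Expr.cost]) rfl
    refine start.seq fun M₁ hM₁ => ?_
    have start' : Runs (.store (d + 1) (.lit 0) (.lit 0)) (Polynomial.eval n 3) M₁ fun M' =>
        M' = setReg M₁ (d + 1) 0 := Runs.store (by simp [Expr.cost]) rfl
    refine start'.seq fun M₂ hM₂ => ?_
    let f : ℕ → ℕ := fun i => x.eval M (Function.update (fun w => M (σ w) 0) v i)
    let Inv : ℕ → Memory → Prop := fun i M' => (∀ a < d, M' a = M a) ∧ M' (d + 1) 0 = i ∧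
      M' d 0 = ∑ j ∈ Finset.range i, f j
    have h6 : Polynomial.eval n 6 = 6 := by simp
    rw [h6]
    refine (Runs.forLoop Inv (fun i M' h => ⟨by rw [h.1 0 hd], h.2.1⟩) ?_ ?_).mono le_rfl ?_
    · intro i hi M' hI
      have hM0 : M' 0 0 = n := by rw [hI.1 0 hd]
      have hrun := ih (Function.update σ v (d + 1)) (d + 2) (fun w => by
        by_cases hw : w = v
        · subst hw; simp
        · rw [Function.update_of_ne hw]; have := hσ w; omega)
        (lift _ d _ (by omega) hx.2) (by omega) M'
      rw [hM0] at hrun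
      refine hrun.seq fun M₃ hM₃ => ?_
      have hval : M₃ (d + 2) 0 = f i := by
        rw [hM₃.1, eval_congr (M := M') (M' := M) (fun a ha => hI.1 a (by simpa using ha)) x hx.2]
        congr 1
        funext w
        by_cases hw : w = v
        · subst hw; simp [hI.2.1]
        · rw [Function.update_of_ne hw, Function.update_of_ne hw, hI.1 _ (hσ w)]
      have step : Runs (.store d (.lit 0) (.add (reg d) (reg (d + 2)))) (Polynomial.eval n 7) M₃
          fun M' => M' = setReg M₃ d (M₃ d 0 + M₃ (d + 2) 0) :=
        Runs.store (by simp [Expr.cost]) rfl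
      refine step.seq fun M₄ hM₄ => ?_
      refine Runs.store (by simp [Expr.cost]) ⟨fun a ha => ?_, ?_, ?_⟩
      · rw [Function.update_of_ne (by omega), hM₄, setReg, Function.update_of_ne (by omega),
          hM₃.2 a (by omega), hI.1 a ha]
      · simp [Expr.eval, hM₄, hM₃.2 (d + 1) (by omega), hI.2.1]
      · simp [hM₄, hval, hM₃.2 d (by omega), hI.2.2, Finset.sum_range_succ]
    · subst hM₂ hM₁
      refine ⟨fun a ha => ?_, by simp, by simp⟩
      rw [setReg, setReg, Function.update_of_ne (by omega), Function.update_of_ne (by omega)]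
    · intro M' hI
      exact ⟨hI.2.2, hI.1⟩

end Ex

/-! ### Straight-line programs that tabulate expressions -/

/-- The arrays from `scratch` on are used as scratch space. -/
abbrev scratch : ℕ := 40

/-- Commands that compute a number, a vector, or a square matrix. -/
inductive Cmd where
  | set (a : ℕ) (x : Ex)
  | fill₁ (a : ℕ) (x : Ex)
  | fill₂ (a : ℕ) (x : Ex)

namespace Cmd

/-- The array that is written. -/
def target : Cmd → ℕ
  | set a _ => a
  | fill₁ a _ => a
  | fill₂ a _ => a

/-- The expression for the entries. -/
def body : Cmd → Ex
  | set _ x => x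
  | fill₁ _ x => x
  | fill₂ _ x => x

/-- The condition that a command establishes. The row and the column number of an entry of a
matrix are the variables `0` and `1`; matrices are stored row by row. -/
def Holds (n : ℕ) (M : Memory) : Cmd → Prop
  | set a x => M a 0 = x.eval M fun _ => 0
  | fill₁ a x => ∀ i < n, M a i = x.eval M fun _ => i
  | fill₂ a x => ∀ i < n, ∀ j < n, M a (i * n + j) = x.eval M fun v => if v = 0 then i else j

/-- A program for a command. The registers `scratch` and `scratch + 1` hold the row and the column
number; as there is no multiplication, the linear index of a matrix entry is counted in register
`scratch + 2`. -/
def prog : Cmd → Program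
  | set a x => .seq (.store scratch (.lit 0) (.lit 0))
      (.seq (x.comp (fun _ => scratch) (scratch + 1))
        (.store a (.lit 0) (reg (scratch + 1))))
  | fill₁ a x => .seq (.store scratch (.lit 0) (.lit 0)) (forLoop scratch
      (.seq (x.comp (fun _ => scratch) (scratch + 1))
        (.seq (.store a (reg scratch) (reg (scratch + 1)))
          (.store scratch (.lit 0) (.add (reg scratch) (.lit 1))))))
  | fill₂ a x => .seq (.store scratch (.lit 0) (.lit 0))
      (.seq (.store (scratch + 2) (.lit 0) (.lit 0))
        (forLoop scratch (.seq (.store (scratch + 1) (.lit 0) (.lit 0))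
          (.seq (forLoop (scratch + 1)
            (.seq (x.comp (fun v => if v = 0 then scratch else scratch + 1) (scratch + 3))
              (.seq (.store a (reg (scratch + 2)) (reg (scratch + 3)))
                (.seq (.store (scratch + 2) (.lit 0) (.add (reg (scratch + 2)) (.lit 1)))
                  (.store (scratch + 1) (.lit 0) (.add (reg (scratch + 1)) (.lit 1)))))))
            (.store scratch (.lit 0) (.add (reg scratch) (.lit 1)))))))

/-- A bound for the running time of a command, as a polynomial in the content of register `0`. -/
noncomputable def time : Cmd → Polynomial ℕ
  | set _ x => 3 + (x.time + 4)
  | fill₁ _ x => 3 + (Polynomial.X * ((x.time + (5 + 6)) + 6) + 6)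
  | fill₂ _ x => 3 + (3 + (Polynomial.X *
      ((3 + ((Polynomial.X * ((x.time + (5 + (6 + 6))) + 6) + 6) + 6)) + 6) + 6))

lemma holds_congr {n : ℕ} {M M' : Memory} {p : ℕ → Bool} (h : ∀ a, p a = true → M a = M' a)
    (c : Cmd) (ht : M c.target = M' c.target) (hc : c.body.reads p = true) (hM : c.Holds n M) :
    c.Holds n M' := by
  cases c with
  | set a x =>
    simp only [target, body] at ht hc
    simp only [Holds] at hM ⊢
    rw [← ht, hM, Ex.eval_congr h x hc]
  | fill₁ a x =>
    simp only [target, body] at ht hc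
    simp only [Holds] at hM ⊢
    intro i hi
    rw [← ht, hM i hi, Ex.eval_congr h x hc]
  | fill₂ a x =>
    simp only [target, body] at ht hc
    simp only [Holds] at hM ⊢
    intro i hi j hj
    rw [← ht, hM i hi j hj, Ex.eval_congr h x hc]

lemma runs (c : Cmd) (ht : c.target < scratch) (h0 : c.target ≠ 0)
    (hc : c.body.reads (fun b => decide (b < scratch) && !decide (b = c.target)) = true)
    (M : Memory) :
    Runs c.prog (c.time.eval (M 0 0)) M fun M' =>
      (∀ b < scratch, b ≠ c.target → M' b = M b) ∧ c.Holds (M 0 0) M' := by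
  set n := M 0 0 with hn
  have hread : ∀ d, scratch ≤ d → c.body.reads (fun b => decide (b < d)) = true := fun d hd =>
    Ex.reads_mono (fun a h => by
      simp only [Bool.and_eq_true, decide_eq_true_eq] at h ⊢; omega) _ hc
  have hcongr : ∀ M' : Memory, (∀ b < scratch, b ≠ c.target → M' b = M b) → ∀ ρ,
      c.body.eval M' ρ = c.body.eval M ρ := fun M' h ρ =>
    Ex.eval_congr (fun b hb => by
      simp only [Bool.and_eq_true, decide_eq_true_eq, Bool.not_eq_true',
        decide_eq_false_iff_not] at hb
      exact h b hb.1 hb.2) _ hc ρ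
  cases c with
  | set a x =>
    simp only [target, body] at ht h0 hread hcongr ⊢
    simp only [time, Polynomial.eval_add, Holds]
    have start : Runs (.store scratch (.lit 0) (.lit 0)) (Polynomial.eval n 3) M fun M' =>
        M' = Ex.setReg M scratch 0 := Runs.store (by simp [Expr.cost]) rfl
    refine start.seq fun M₁ hM₁ => ?_
    have hf : ∀ b < scratch, M₁ b = M b := fun b hb => by
      rw [hM₁, Ex.setReg, Function.update_of_ne (by omega)]
    have hrun := x.comp_runs (fun _ => scratch) (scratch + 1) (fun _ => Nat.lt_succ_self _)
      (hread _ (Nat.le_succ _)) (Nat.succ_pos _) M₁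
    rw [hf 0 (by omega), ← hn] at hrun
    refine hrun.seq fun M₂ hM₂ => ?_
    have hf₂ : ∀ b < scratch, M₂ b = M b := fun b hb => by rw [hM₂.2 b (by omega), hf b hb]
    have hk : ∀ b < scratch, b ≠ a → (Function.update M₂ a (Function.update (M₂ a)
        ((Expr.lit 0).eval M₂) ((reg (scratch + 1)).eval M₂))) b = M b := fun b hb hba => by
      rw [Function.update_of_ne hba, hf₂ b hb]
    refine Runs.store (by simp [Expr.cost]) ⟨hk, ?_⟩
    rw [hcongr _ hk]
    simp only [Function.update_self, Expr.eval, hM₂.1]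
    rw [hcongr M₁ fun b hb _ => hf b hb]
    simp [hM₁]
  | fill₁ a x =>
    simp only [target, body] at ht h0 hread hcongr ⊢
    simp only [time, Polynomial.eval_add, Polynomial.eval_mul, Polynomial.eval_X, Holds]
    have start : Runs (.store scratch (.lit 0) (.lit 0)) (Polynomial.eval n 3) M fun M' =>
        M' = Ex.setReg M scratch 0 := Runs.store (by simp [Expr.cost]) rfl
    refine start.seq fun M₁ hM₁ => ?_
    let Inv : ℕ → Memory → Prop := fun i M' => (∀ b < scratch, b ≠ a → M' b = M b) ∧
      M' scratch 0 = i ∧ ∀ j < i, M' a j = x.eval M fun _ => j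
    have h6 : Polynomial.eval n 6 = 6 := by simp
    rw [h6]
    refine (Runs.forLoop Inv (fun i M' h => ⟨by rw [h.1 0 (by omega) h0.symm], h.2.1⟩)
      ?_ ?_).mono le_rfl ?_
    · intro i hi M' hI
      have hrun := x.comp_runs (fun _ => scratch) (scratch + 1) (fun _ => Nat.lt_succ_self _)
        (hread _ (Nat.le_succ _)) (Nat.succ_pos _) M'
      rw [hI.1 0 (by omega) h0.symm, ← hn, hcongr M' hI.1, hI.2.1] at hrun
      refine hrun.seq fun M₂ hM₂ => ?_
      have step : Runs (.store a (reg scratch) (reg (scratch + 1))) (Polynomial.eval n 5) M₂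
          fun M' => M' = Function.update M₂ a (Function.update (M₂ a) (M₂ scratch 0)
            (M₂ (scratch + 1) 0)) := Runs.store (by simp [Expr.cost]) rfl
      refine step.seq fun M₃ hM₃ => ?_
      refine Runs.store (by simp [Expr.cost]) ⟨fun b hb hba => ?_, ?_, fun j hj => ?_⟩
      · rw [Function.update_of_ne (by omega), hM₃, Function.update_of_ne hba, hM₂.2 b (by omega),
          hI.1 b hb hba]
      · have : scratch ≠ a := by omega
        simp [Expr.eval, hM₃, Function.update_of_ne this, hM₂.2 scratch (by omega), hI.2.1]
      · rw [Function.update_of_ne (by omega), hM₃, Function.update_self, hM₂.1,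
          hM₂.2 scratch (by omega), hI.2.1]
        by_cases hji : j = i
        · subst hji; rw [Function.update_self]
        · rw [Function.update_of_ne hji, hM₂.2 a (by omega), hI.2.2 j (by omega)]
    · subst hM₁
      exact ⟨fun b hb _ => Function.update_of_ne (by omega) _ _, by simp,
        fun j hj => absurd hj (Nat.not_lt_zero j)⟩
    · intro M' hI
      refine ⟨hI.1, fun i hi => ?_⟩
      rw [hI.2.2 i hi, hcongr M' hI.1]
  | fill₂ a x =>
    simp only [target, body] at ht h0 hread hcongr ⊢
    simp only [time, Polynomial.eval_add, Polynomial.eval_mul, Polynomial.eval_X, Holds]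
    have start : Runs (.store scratch (.lit 0) (.lit 0)) (Polynomial.eval n 3) M fun M' =>
        M' = Ex.setReg M scratch 0 := Runs.store (by simp [Expr.cost]) rfl
    refine start.seq fun M₁ hM₁ => ?_
    have start₂ : Runs (.store (scratch + 2) (.lit 0) (.lit 0)) (Polynomial.eval n 3) M₁ fun M' =>
        M' = Ex.setReg M₁ (scratch + 2) 0 := Runs.store (by simp [Expr.cost]) rfl
    refine start₂.seq fun M₂ hM₂ => ?_
    -- the entry with linear index `q`
    let f : ℕ → ℕ := fun q => x.eval M fun v => if v = 0 then q / n else q % n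
    -- the first `q` entries have been written, and register `scratch + 2` holds `q`
    let Fr : ℕ → Memory → Prop := fun q M' => (∀ b < scratch, b ≠ a → M' b = M b) ∧
      M' (scratch + 2) 0 = q ∧ ∀ r < q, M' a r = f r
    let Inv : ℕ → Memory → Prop := fun i M' => Fr (i * n) M' ∧ M' scratch 0 = i
    have h6 : Polynomial.eval n 6 = 6 := by simp
    rw [h6]
    refine (Runs.forLoop Inv (fun i M' h => ⟨by rw [h.1.1 0 (by omega) h0.symm], h.2⟩)
      ?_ ?_).mono le_rfl ?_
    · intro i hi M' hI
      have first : Runs (.store (scratch + 1) (.lit 0) (.lit 0)) (Polynomial.eval n 3) M' fun M'' =>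
        M'' = Ex.setReg M' (scratch + 1) 0 := Runs.store (by simp [Expr.cost]) rfl
      refine first.seq fun M₃ hM₃ => ?_
      let Inv' : ℕ → Memory → Prop := fun j M' => Fr (i * n + j) M' ∧ M' scratch 0 = i ∧
        M' (scratch + 1) 0 = j
      have hin : Runs _ _ M₃ (Inv' n) :=
        Runs.forLoop (c := scratch + 1) (n := n) (T := Polynomial.eval n x.time +
            (Polynomial.eval n 5 + (6 + 6)))
          (p := (.seq (x.comp (fun v => if v = 0 then scratch else scratch + 1) (scratch + 3))
              (.seq (.store a (reg (scratch + 2)) (reg (scratch + 3)))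
                (.seq (.store (scratch + 2) (.lit 0) (.add (reg (scratch + 2)) (.lit 1)))
                  (.store (scratch + 1) (.lit 0) (.add (reg (scratch + 1)) (.lit 1)))))))
          Inv' (fun j M' h => ⟨by rw [h.1.1 0 (by omega) h0.symm], h.2.2⟩) (by
        intro j hj M' hJ
        have hrun := x.comp_runs (fun v => if v = 0 then scratch else scratch + 1) (scratch + 3)
          (fun v => by split_ifs <;> omega) (hread _ (by omega)) (Nat.succ_pos _) M'
        have henv : x.eval M' (fun v => M' (if v = 0 then scratch else scratch + 1) 0) =
            f (i * n + j) := by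
          rw [hcongr M' hJ.1.1]
          simp only [f]
          congr 1
          funext v
          have hn0 : 0 < n := by omega
          rw [mul_comm i n, Nat.mul_add_div hn0, Nat.div_eq_of_lt hj, Nat.mul_add_mod,
            Nat.mod_eq_of_lt hj]
          split_ifs
          · rw [hJ.2.1, add_zero]
          · rw [hJ.2.2]
        rw [hJ.1.1 0 (by omega) h0.symm, ← hn, henv] at hrun
        refine hrun.seq fun M₄ hM₄ => ?_
        have step : Runs (.store a (reg (scratch + 2)) (reg (scratch + 3))) (Polynomial.eval n 5)
            M₄ fun M' => M' = Function.update M₄ a (Function.update (M₄ a) (M₄ (scratch + 2) 0)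
              (M₄ (scratch + 3) 0)) := Runs.store (by simp [Expr.cost]) rfl
        refine step.seq fun M₅ hM₅ => ?_
        have step₂ : Runs (.store (scratch + 2) (.lit 0) (.add (reg (scratch + 2)) (.lit 1))) 6
            M₅ fun M' => M' = Ex.setReg M₅ (scratch + 2) (M₅ (scratch + 2) 0 + 1) :=
          Runs.store (by simp [Expr.cost]) rfl
        refine step₂.seq fun M₆ hM₆ => ?_
        have e0 : scratch ≠ a := by omega
        have e1 : scratch + 1 ≠ a := by omega
        have e2 : scratch + 2 ≠ a := by omega
        have f0 : M₅ scratch = M' scratch := by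
          rw [hM₅, Function.update_of_ne e0, hM₄.2 scratch (by omega)]
        have f1 : M₅ (scratch + 1) = M' (scratch + 1) := by
          rw [hM₅, Function.update_of_ne e1, hM₄.2 (scratch + 1) (by omega)]
        have f2 : M₅ (scratch + 2) = M' (scratch + 2) := by
          rw [hM₅, Function.update_of_ne e2, hM₄.2 (scratch + 2) (by omega)]
        have hother : ∀ b, b ≠ scratch + 1 → b ≠ scratch + 2 →
            (Function.update M₆ (scratch + 1) (Function.update (M₆ (scratch + 1))
              ((Expr.lit 0).eval M₆) (((reg (scratch + 1)).add (.lit 1)).eval M₆))) b = M₅ b := by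
          intro b hb1 hb2
          rw [Function.update_of_ne hb1, hM₆, Ex.setReg, Function.update_of_ne hb2]
        refine Runs.store (by simp [Expr.cost]) ⟨⟨fun b hb hba => ?_, ?_, fun r hr => ?_⟩, ?_, ?_⟩
        · rw [hother b (by omega) (by omega), hM₅, Function.update_of_ne hba,
            hM₄.2 b (by omega), hJ.1.1 b hb hba]
        · rw [Function.update_of_ne (by omega), hM₆, Ex.setReg, Function.update_self,
            Function.update_self, f2, hJ.1.2.1]
          omega
        · rw [hother a (by omega) (by omega), hM₅, Function.update_self, hM₄.1,
            hM₄.2 (scratch + 2) (by omega), hJ.1.2.1]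
          by_cases hrq : r = i * n + j
          · subst hrq; rw [Function.update_self]
          · rw [Function.update_of_ne hrq, hM₄.2 a (by omega), hJ.1.2.2 r (by omega)]
        · rw [hother scratch (by omega) (by omega), f0, hJ.2.1]
        · simp only [Expr.eval, Function.update_self, hM₆, Ex.setReg]
          rw [Function.update_of_ne (by omega), f1, hJ.2.2]) (M := M₃) (by
        have hb : ∀ b, b ≠ scratch + 1 → M₃ b = M' b := fun b hb => by
          rw [hM₃, Ex.setReg, Function.update_of_ne hb]
        refine ⟨⟨fun b hb' hba => ?_, ?_, fun r hr => ?_⟩, ?_, ?_⟩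
        · rw [hb b (by omega), hI.1.1 b hb' hba]
        · rw [hb _ (by omega), hI.1.2.1, add_zero]
        · rw [hb a (by omega), hI.1.2.2 r (by omega)]
        · rw [hb _ (by omega), hI.2]
        · rw [hM₃, Ex.setReg, Function.update_self, Function.update_self])
      refine hin.seq fun M₄ hM₄ => ?_
      refine Runs.store (by simp [Expr.cost]) ?_
      have hb : ∀ b, b ≠ scratch → (Function.update M₄ scratch (Function.update (M₄ scratch)
          ((Expr.lit 0).eval M₄) (((reg scratch).add (.lit 1)).eval M₄))) b = M₄ b := fun b hb =>
        Function.update_of_ne hb _ _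
      refine ⟨⟨fun b hb' hba => ?_, ?_, fun r hr => ?_⟩, ?_⟩
      · rw [hb b (by omega), hM₄.1.1 b hb' hba]
      · rw [hb _ (by omega), hM₄.1.2.1, Nat.succ_mul]
      · rw [hb a (by omega), hM₄.1.2.2 r (by rwa [Nat.succ_mul] at hr)]
      · simp only [Expr.eval, Function.update_self, hM₄.2.1]
    · have hb : ∀ b, b ≠ scratch → b ≠ scratch + 2 → M₂ b = M b := fun b h1 h2 => by
        rw [hM₂, Ex.setReg, Function.update_of_ne h2, hM₁, Ex.setReg, Function.update_of_ne h1]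
      refine ⟨⟨fun b hb' _ => hb b (by omega) (by omega), ?_, fun r hr => ?_⟩, ?_⟩
      · rw [hM₂, Ex.setReg, Function.update_self, Function.update_self, zero_mul]
      · rw [zero_mul] at hr
        exact absurd hr (Nat.not_lt_zero r)
      · rw [hM₂, Ex.setReg, Function.update_of_ne (by omega), hM₁, Ex.setReg, Function.update_self,
          Function.update_self]
    · intro M' hI
      refine ⟨hI.1.1, fun i hi j hj => ?_⟩
      have hlt : i * n + j < n * n := by
        have := Nat.mul_le_mul_right n (Nat.succ_le_of_lt hi)
        rw [Nat.succ_mul] at this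
        omega
      rw [hI.1.2.2 _ hlt, hcongr M' hI.1.1]
      simp only [f]
      congr 1
      funext v
      have hn0 : 0 < n := by omega
      rw [mul_comm i n, Nat.mul_add_div hn0, Nat.div_eq_of_lt hj, Nat.mul_add_mod,
        Nat.mod_eq_of_lt hj, add_zero]

/-- Each array is written by one command only, and read by later commands only. -/
def wellFormed : List Cmd → Bool
  | [] => true
  | c :: cs => decide (c.target < scratch) && !decide (c.target = 0) &&
      !decide (c.target ∈ cs.map target) &&
      c.body.reads (fun b => decide (b < scratch) && !decide (b = c.target) &&
        !decide (b ∈ cs.map target)) && wellFormed cs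

/-- The sequential composition of the programs for a list of commands. -/
def progs : List Cmd → Program
  | [] => .skip
  | c :: cs => .seq c.prog (progs cs)

/-- A bound for the running time of `Cmd.progs`. -/
noncomputable def times : List Cmd → Polynomial ℕ
  | [] => 1
  | c :: cs => c.time + times cs

/-- In the final memory, the conditions established by all commands hold simultaneously. -/
lemma progs_runs (cs : List Cmd) (hw : wellFormed cs = true) (M : Memory) :
    Runs (progs cs) ((times cs).eval (M 0 0)) M fun M' =>
      (∀ b < scratch, b ∉ cs.map target → M' b = M b) ∧ ∀ c ∈ cs, c.Holds (M 0 0) M' := by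
  induction cs generalizing M with
  | nil => exact ⟨1, M, .skip M, by simp [times], fun b _ _ => rfl, by simp⟩
  | cons c cs ih =>
    simp only [wellFormed, Bool.and_eq_true, decide_eq_true_eq, Bool.not_eq_true',
      decide_eq_false_iff_not] at hw
    obtain ⟨⟨⟨⟨h1, h2⟩, h3⟩, h4⟩, h5⟩ := hw
    simp only [times, Polynomial.eval_add, progs]
    refine (c.runs h1 h2 (Ex.reads_mono (fun b hb => ?_) _ h4) M).seq fun M₁ hM₁ => ?_
    · simp only [Bool.and_eq_true] at hb ⊢
      exact hb.1
    · have h0 : M₁ 0 0 = M 0 0 := by rw [hM₁.1 0 (by omega) (Ne.symm h2)]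
      have := ih h5 M₁
      rw [h0] at this
      refine this.mono le_rfl fun M' hM' => ⟨fun b hb hbt => ?_, fun c' hc' => ?_⟩
      · simp only [List.map_cons, List.mem_cons, not_or] at hbt
        rw [hM'.1 b hb hbt.2, hM₁.1 b hb hbt.1]
      · rcases List.mem_cons.1 hc' with rfl | hc'
        · refine holds_congr (fun b hb => ?_) _ (hM'.1 _ h1 h3).symm h4 hM₁.2
          simp only [Bool.and_eq_true, decide_eq_true_eq, Bool.not_eq_true',
            decide_eq_false_iff_not] at hb
          exact (hM'.1 b hb.1.1 hb.2).symm
        · exact hM'.2 c' hc'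

end Cmd

/-! ### Formulas and counting as expressions -/

/-- Numbers stand for truth values; all numbers except `0` mean true. -/
def NZ (x : ℕ) : Prop := x ≠ 0

instance (x : ℕ) : Decidable (NZ x) := inferInstanceAs (Decidable (x ≠ 0))

namespace Ex

/-- Negation. -/
def notE (x : Ex) : Ex := ite x (lit 0) (lit 1)

/-- Conjunction. -/
def andE (x y : Ex) : Ex := ite x y (lit 0)

/-- Disjunction. -/
def orE (x y : Ex) : Ex := ite x (lit 1) y

/-- Implication. -/
def impE (x y : Ex) : Ex := ite x y (lit 1)

/-- Equivalence. -/
def iffE (x y : Ex) : Ex := ite x y (notE y)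

/-- The test `x < y`. -/
def ltE (x y : Ex) : Ex := sub y x

/-- The test `x = y`. -/
def eqE (x y : Ex) : Ex := notE (add (sub x y) (sub y x))

/-- Existential quantification over the vertices. -/
def exE (v : ℕ) (x : Ex) : Ex := sum v x

/-- Universal quantification over the vertices. -/
def allE (v : ℕ) (x : Ex) : Ex := notE (exE v (notE x))

/-- The number of vertices that satisfy a formula. -/
def cntE (v : ℕ) (x : Ex) : Ex := sum v (ite x (lit 1) (lit 0))

/-- The entry of a vector. -/
def at₁ (a u : ℕ) : Ex := cell a (var u)

/-- The entry of a matrix; the row number is multiplied by the number of vertices by means of a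
sum, whose variable is `9`. -/
def at₂ (a u v : ℕ) : Ex := cell a (add (sum 9 (var u)) (var v))

variable {M : Memory} {ρ : ℕ → ℕ} {x y : Ex} {n : ℕ}

lemma nz_notE : NZ ((notE x).eval M ρ) ↔ ¬ NZ (x.eval M ρ) := by
  simp only [notE, eval, NZ]; split_ifs with h <;> simp [h]

lemma nz_andE : NZ ((andE x y).eval M ρ) ↔ NZ (x.eval M ρ) ∧ NZ (y.eval M ρ) := by
  simp only [andE, eval, NZ]; split_ifs with h <;> simp [h]

lemma nz_orE : NZ ((orE x y).eval M ρ) ↔ NZ (x.eval M ρ) ∨ NZ (y.eval M ρ) := by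
  simp only [orE, eval, NZ]; split_ifs with h <;> simp [h]

lemma nz_impE : NZ ((impE x y).eval M ρ) ↔ (NZ (x.eval M ρ) → NZ (y.eval M ρ)) := by
  simp only [impE, eval, NZ]; split_ifs with h <;> simp [h]

lemma nz_iffE : NZ ((iffE x y).eval M ρ) ↔ (NZ (x.eval M ρ) ↔ NZ (y.eval M ρ)) := by
  have := @nz_notE M ρ y
  simp only [NZ] at this
  simp only [iffE, eval, NZ]; split_ifs with h
  · simp [h]
  · rw [this]; simp only [h, false_iff]

lemma nz_ltE : NZ ((ltE x y).eval M ρ) ↔ x.eval M ρ < y.eval M ρ := by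
  simp only [ltE, eval, NZ]; omega

lemma nz_eqE : NZ ((eqE x y).eval M ρ) ↔ x.eval M ρ = y.eval M ρ := by
  rw [eqE, nz_notE]; simp only [eval, NZ]; omega

lemma nz_exE (hn : M 0 0 = n) {v : ℕ} :
    NZ ((exE v x).eval M ρ) ↔ ∃ i : Fin n, NZ (x.eval M (Function.update ρ v i)) := by
  simp only [exE, eval, NZ, hn]
  simp only [ne_eq, Finset.sum_eq_zero_iff, Finset.mem_range, not_forall, Fin.exists_iff]

lemma nz_allE (hn : M 0 0 = n) {v : ℕ} :
    NZ ((allE v x).eval M ρ) ↔ ∀ i : Fin n, NZ (x.eval M (Function.update ρ v i)) := by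
  simp only [allE, nz_notE, nz_exE hn, not_exists, not_not]

lemma eval_sum (hn : M 0 0 = n) {v : ℕ} :
    (sum v x).eval M ρ = ∑ i : Fin n, x.eval M (Function.update ρ v i) := by
  simp only [eval, hn, Finset.sum_range]

lemma eval_cntE (hn : M 0 0 = n) {v : ℕ} :
    (cntE v x).eval M ρ = cnt fun i : Fin n => NZ (x.eval M (Function.update ρ v i)) := by
  classical
  rw [cntE, eval_sum hn, cnt_eq_card, Finset.card_filter]
  simp only [eval, NZ]
  exact Finset.sum_congr rfl fun i _ => by congr

lemma eval_at₁ {a u : ℕ} : (at₁ a u).eval M ρ = M a (ρ u) := rfl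

lemma eval_at₂ (hn : M 0 0 = n) {a u v : ℕ} (hu : u ≠ 9) :
    (at₂ a u v).eval M ρ = M a (ρ u * n + ρ v) := by
  simp only [at₂, eval, Function.update_of_ne hu, Finset.sum_const, Finset.card_range, hn,
    smul_eq_mul, mul_comm]

lemma eval_var {v : ℕ} : (var v).eval M ρ = ρ v := rfl

lemma eval_ite {c : Ex} : (ite c x y).eval M ρ =
    if NZ (c.eval M ρ) then x.eval M ρ else y.eval M ρ := rfl

lemma eval_lit {c : ℕ} : (lit c).eval M ρ = c := rfl

lemma eval_add : (add x y).eval M ρ = x.eval M ρ + y.eval M ρ := rfl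

lemma eval_sub : (sub x y).eval M ρ = x.eval M ρ - y.eval M ρ := rfl

/-- The content of a register. -/
def regE (a : ℕ) : Ex := cell a (lit 0)

lemma eval_regE {a : ℕ} : (regE a).eval M ρ = M a 0 := rfl

/-- The number `2 k`. -/
def twoK : Ex := add (regE 1) (regE 1)

lemma eval_twoK : twoK.eval M ρ = 2 * M 1 0 := (two_mul _).symm

end Ex

/-! ### The program for the kernel -/

section KernelProgram

open Ex Cmd

/-- The commands that compute the data of the kernel: the closed neighbourhoods (array `4`), the
vertices satisfying `Big` (`5`), the closed neighbourhoods in the graph `Instance.base` (`6`) and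
their sizes (`7`), the predicates `Iso`, `Large`, `Lead`, `First`, `Kept` (`8` to `12`), the ranks
of the kept vertices (`13`), the number of kept vertices (`14`) and its products with the ranks
(`15`), the number of forced deletions (`16`) and the new `k` (`17`), the excess (`18`) and the new
`η` (`19`), and the truth value of `Instance.Bad` (`20`). -/
def analysis : List Cmd :=
  [fill₂ 4 (orE (eqE (var 0) (var 1)) (at₂ 3 0 1)),
   fill₁ 5 (andE (allE 2 (allE 3 (impE (at₂ 4 0 2) (impE (at₂ 4 0 3) (at₂ 4 2 3)))))
     (ltE twoK (cntE 2 (at₂ 4 0 2)))),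
   fill₂ 6 (orE (eqE (var 0) (var 1)) (andE (at₂ 3 0 1)
     (allE 2 (impE (at₁ 5 2) (iffE (at₂ 4 2 0) (at₂ 4 2 1)))))),
   fill₁ 7 (cntE 2 (at₂ 6 0 2)),
   fill₁ 8 (allE 2 (impE (at₂ 6 0 2) (allE 3 (iffE (at₂ 6 0 3) (at₂ 6 2 3))))),
   fill₁ 9 (andE (at₁ 8 0) (ltE twoK (at₁ 7 0))),
   fill₁ 10 (andE (andE (at₁ 8 0) (notE (ltE twoK (at₁ 7 0))))
     (allE 2 (impE (at₂ 6 0 2) (notE (ltE (var 2) (var 0)))))),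
   fill₁ 11 (andE (at₁ 10 0) (ltE (cntE 2 (andE (ltE (var 2) (var 0))
     (andE (at₁ 10 2) (eqE (at₁ 7 2) (at₁ 7 0))))) (add twoK (lit 1)))),
   fill₁ 12 (orE (orE (notE (at₁ 8 0)) (exE 2 (andE (at₂ 6 0 2) (at₁ 11 2))))
     (andE (at₁ 9 0) (ltE (cntE 2 (andE (ltE (var 2) (var 0)) (at₁ 9 2))) (add twoK (lit 1))))),
   fill₁ 13 (cntE 2 (andE (ltE (var 2) (var 0)) (at₁ 12 2))),
   set 14 (cntE 2 (at₁ 12 2)),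
   fill₁ 15 (sum 2 (ite (andE (ltE (var 2) (var 0)) (at₁ 12 2)) (regE 14) (lit 0))),
   set 16 (sum 2 (cntE 3 (andE (ltE (var 2) (var 3)) (andE (at₂ 3 2 3) (notE (at₂ 6 2 3)))))),
   set 17 (sub (regE 1) (regE 16)),
   set 18 (cntE 2 (exE 3 (andE (at₁ 9 3)
     (ltE (add (add twoK (lit 1)) (var 2)) (at₁ 7 3))))),
   set 19 (sub (sub (regE 2) (regE 18)) (sub (sub (regE 2) (regE 18)) (regE 14))),
   set 20 (orE (ltE (regE 1) (regE 16)) (orE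
     (ltE (sum 2 (ite (ltE (var 2) twoK) twoK (lit 0))) (cntE 2 (notE (at₁ 8 2))))
     (exE 2 (exE 3 (andE (at₁ 9 2) (andE (at₁ 9 3)
       (ltE (add (at₁ 7 3) (regE 2)) (at₁ 7 2))))))))]

/-- The commands that overwrite the adjacency matrix, `k`, and `η` by those of the reduced
instance. The new matrix is written in the row format for the old number of vertices; the entry of
linear index `q` belongs to the pair of kept vertices whose ranks `i`, `j` satisfy
`i * n' + j = q`. -/
def output : List Cmd :=
  [fill₂ 3 (ite (exE 2 (exE 3 (andE (at₁ 12 2) (andE (at₁ 12 3)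
     (andE (eqE (add (at₁ 15 2) (at₁ 13 3)) (add (sum 9 (var 0)) (var 1)))
       (andE (notE (eqE (var 2) (var 3)))
         (orE (andE (at₁ 9 2) (at₁ 9 3)) (at₂ 6 2 3)))))))) (lit 1) (lit 0)),
   set 1 (regE 17),
   set 2 (regE 19)]

lemma analysis_wellFormed : wellFormed analysis = true := by decide

lemma output_wellFormed : wellFormed output = true := by decide

/-- A program that writes a number into a cell. -/
abbrev put (a i c : ℕ) : Program := .store a (.lit i) (.lit c)

/-- A program that writes `noInstance`. -/
def writeNo : Program :=
  .seq (put 3 0 0) (.seq (put 3 1 1) (.seq (put 3 2 0) (.seq (put 3 3 1) (.seq (put 3 4 0)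
    (.seq (put 3 5 1) (.seq (put 3 6 0) (.seq (put 3 7 1) (.seq (put 3 8 0)
      (.seq (put 1 0 0) (.seq (put 2 0 0) (put 0 0 3)))))))))))

/-- The program for the kernel. -/
def kernelProgram : Program :=
  .seq (progs analysis) (.ite (reg 20) writeNo (.seq (progs output) (.store 0 (.lit 0) (reg 14))))

lemma writeNo_runs (M : Memory) : Runs writeNo 36 M noInstance.IsOutput := by
  classical
  have hput : ∀ (a i c : ℕ) (M : Memory), Runs (put a i c) 3 M fun M' =>
      M' = Function.update M a (Function.update (M a) i c) := fun a i c M =>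
    Runs.store (by simp [Expr.cost]) rfl
  unfold writeNo
  refine (Runs.seq (hput 3 0 0 M) fun M₁ h₁ => Runs.seq (hput 3 1 1 M₁) fun M₂ h₂ =>
    Runs.seq (hput 3 2 0 M₂) fun M₃ h₃ => Runs.seq (hput 3 3 1 M₃) fun M₄ h₄ =>
    Runs.seq (hput 3 4 0 M₄) fun M₅ h₅ => Runs.seq (hput 3 5 1 M₅) fun M₆ h₆ =>
    Runs.seq (hput 3 6 0 M₆) fun M₇ h₇ => Runs.seq (hput 3 7 1 M₇) fun M₈ h₈ =>
    Runs.seq (hput 3 8 0 M₈) fun M₉ h₉ => Runs.seq (hput 1 0 0 M₉) fun M₁₀ h₁₀ =>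
    Runs.seq (hput 2 0 0 M₁₀) fun M₁₁ h₁₁ => (hput 0 0 3 M₁₁).mono le_rfl ?_).mono
      (by norm_num) fun _ h => h
  intro M₁₂ h₁₂
  have h3 : M₁₂ 3 = M₉ 3 := by
    rw [h₁₂, Function.update_of_ne (by decide), h₁₁, Function.update_of_ne (by decide), h₁₀,
      Function.update_of_ne (by decide)]
  refine ⟨by simp [h₁₂, noInstance], by simp [h₁₂, h₁₁, h₁₀, noInstance],
    by simp [h₁₂, h₁₁, noInstance], ?_⟩
  intro u v
  rw [h3]
  have hM : ∀ i, M₉ 3 i = if i = 1 ∨ i = 3 ∨ i = 5 ∨ i = 7 then 1 else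
      if i ≤ 8 then 0 else M 3 i := by
    intro i
    simp only [h₉, h₈, h₇, h₆, h₅, h₄, h₃, h₂, h₁, Function.update_self, Function.update_apply]
    split_ifs <;> omega
  refine (hM _).trans ?_
  have hadj : ∀ u v : Fin 3, noInstance.G.Adj u v ↔ u ≠ v ∧ (u = 1 ∨ v = 1) := fun _ _ => Iff.rfl
  have key : ∀ u v : Fin 3, (if (u : ℕ) * 3 + v = 1 ∨ (u : ℕ) * 3 + v = 3 ∨
      (u : ℕ) * 3 + v = 5 ∨ (u : ℕ) * 3 + v = 7 then 1 else
      if (u : ℕ) * 3 + v ≤ 8 then 0 else M 3 (u * 3 + v)) =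
      if noInstance.G.Adj u v then 1 else 0 := by
    intro u v
    simp only [hadj]
    fin_cases u <;> fin_cases v <;> simp
  exact key u v

/-! ### Correctness of the program -/

lemma encode_adj (I : Instance) (u v : Fin I.n) : NZ (I.encode 3 (u * I.n + v)) ↔ I.G.Adj u v := by
  classical
  change (if ∃ u' v' : Fin I.n, I.G.Adj u' v' ∧ (u : ℕ) * I.n + v = (u' : ℕ) * I.n + v'
    then 1 else 0) ≠ 0 ↔ _
  have hpos : 0 < I.n := u.pos
  have hdiv : ∀ a b : Fin I.n, ((a : ℕ) * I.n + b) / I.n = a ∧ ((a : ℕ) * I.n + b) % I.n = b := by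
    intro a b
    rw [mul_comm, Nat.mul_add_div hpos, Nat.div_eq_of_lt b.2, Nat.mul_add_mod,
      Nat.mod_eq_of_lt b.2]
    exact ⟨rfl, rfl⟩
  split_ifs with h
  · obtain ⟨u', v', h1, h2⟩ := h
    have hu : u = u' := Fin.ext (by rw [← (hdiv u v).1, h2, (hdiv u' v').1])
    have hv : v = v' := Fin.ext (by rw [← (hdiv u v).2, h2, (hdiv u' v').2])
    subst hu hv
    simp [h1]
  · simp only [ne_eq, not_true_eq_false, false_iff]
    exact fun h' => h ⟨u, v, h', rfl⟩

/-- The data of the kernel that `analysis` stores. -/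
structure Analysed (I : Instance) (M : Memory) : Prop where
  n_eq : M 0 0 = I.n
  relB : ∀ u v : Fin I.n, NZ (M 6 (u * I.n + v)) ↔ Rel I.base u v
  large : ∀ u : Fin I.n, NZ (M 9 u) ↔ Large I.base I.k u
  kept : ∀ u : Fin I.n, NZ (M 12 u) ↔ Kept I.base I.k u
  rank : ∀ u : Fin I.n, M 13 u = rank (Kept I.base I.k) u
  num : M 14 0 = I.keptNum
  rank_mul : ∀ u : Fin I.n, M 15 u = BCD.rank (Kept I.base I.k) u * I.keptNum
  k_eq : M 17 0 = I.k - I.forced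
  η_eq : M 19 0 = min (I.η - I.excess) I.keptNum
  bad : NZ (M 20 0) ↔ I.Bad

lemma analysed (I : Instance) (M : Memory) (h0 : M 0 0 = I.n) (h1 : M 1 0 = I.k)
    (h2 : M 2 0 = I.η) (h3 : ∀ u v : Fin I.n, NZ (M 3 (u * I.n + v)) ↔ I.G.Adj u v)
    (h : ∀ c ∈ analysis, c.Holds I.n M) : Analysed I M := by
  simp only [analysis, List.mem_cons, List.not_mem_nil, or_false, forall_eq_or_imp, forall_eq,
    Holds] at h
  obtain ⟨h4, h5, h6, h7, h8, h9, h10, h11, h12, h13, h14, h15, h16, h17, h18, h19, h20⟩ := h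
  replace h4 : ∀ u v : Fin I.n, NZ (M 4 (u * I.n + v)) ↔ Rel I.G u v := by
    intro u v
    rw [h4 u u.2 v v.2]
    simp [nz_orE, nz_eqE, eval_var, eval_at₂ h0, h3, Rel, Fin.val_inj]
  replace h5 : ∀ u : Fin I.n, NZ (M 5 u) ↔ Big I.G I.k u := by
    intro u
    rw [h5 u u.2]
    simp [nz_andE, nz_allE h0, nz_impE, nz_ltE, eval_cntE h0, eval_at₂ h0, h4, h1, Big, nsize,
      eval_twoK]
  replace h6 : ∀ u v : Fin I.n, NZ (M 6 (u * I.n + v)) ↔ Rel I.base u v := by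
    intro u v
    rw [h6 u u.2 v v.2]
    simp [nz_orE, nz_eqE, nz_andE, nz_allE h0, nz_impE, nz_iffE, eval_var, eval_at₁, eval_at₂ h0,
      h3, h4, h5, Rel, Instance.base, cut, Fin.val_inj]
  replace h7 : ∀ u : Fin I.n, M 7 u = nsize I.base u := by
    intro u
    rw [h7 u u.2]
    simp [eval_cntE h0, eval_at₂ h0, h6, nsize]
  replace h8 : ∀ u : Fin I.n, NZ (M 8 u) ↔ Iso I.base u := by
    intro u
    rw [h8 u u.2]
    simp [nz_allE h0, nz_impE, nz_iffE, eval_at₂ h0, h6, Iso]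
  replace h9 : ∀ u : Fin I.n, NZ (M 9 u) ↔ Large I.base I.k u := by
    intro u
    rw [h9 u u.2]
    simp [nz_andE, nz_ltE, eval_at₁, eval_twoK, h1, h7, h8, Large]
  replace h10 : ∀ u : Fin I.n, NZ (M 10 u) ↔ Lead I.base I.k u := by
    intro u
    rw [h10 u u.2]
    simp [nz_andE, nz_notE, nz_allE h0, nz_impE, nz_ltE, eval_at₁, eval_at₂ h0, eval_var,
      eval_twoK, h1, h6, h7, h8, Lead]
  replace h11 : ∀ u : Fin I.n, NZ (M 11 u) ↔ First I.base I.k u := by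
    intro u
    rw [h11 u u.2]
    simp [nz_andE, nz_ltE, nz_eqE, eval_cntE h0, eval_at₁, eval_var, eval_add, eval_lit,
      eval_twoK, h1, h7, h10, First, BCD.rank]
  replace h12 : ∀ u : Fin I.n, NZ (M 12 u) ↔ Kept I.base I.k u := by
    intro u
    rw [h12 u u.2]
    simp [nz_orE, nz_andE, nz_notE, nz_ltE, nz_exE h0, eval_cntE h0, eval_at₁, eval_at₂ h0,
      eval_var, eval_add, eval_lit, eval_twoK, h1, h6, h8, h9, h11, Kept, Core, BCD.rank]
  replace h13 : ∀ u : Fin I.n, M 13 u = BCD.rank (Kept I.base I.k) u := by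
    intro u
    rw [h13 u u.2]
    simp [nz_andE, nz_ltE, eval_cntE h0, eval_at₁, eval_var, h12, BCD.rank]
  replace h14 : M 14 0 = I.keptNum := by
    rw [h14]
    simp [eval_cntE h0, eval_at₁, h12, Instance.keptNum]
  replace h15 : ∀ u : Fin I.n, M 15 u = BCD.rank (Kept I.base I.k) u * I.keptNum := by
    classical
    intro u
    rw [h15 u u.2, eval_sum h0, BCD.rank, cnt_eq_card, Finset.card_filter, Finset.sum_mul]
    refine Finset.sum_congr rfl fun i _ => ?_
    simp [eval_ite, nz_andE, nz_ltE, eval_var, eval_at₁, eval_regE, eval_lit, h12, h14]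
  replace h16 : M 16 0 = I.forced := by
    rw [h16, eval_sum h0]
    refine Finset.sum_congr rfl fun u _ => ?_
    rw [eval_cntE h0]
    refine cnt_congr fun v => ?_
    simp only [nz_andE, nz_notE, nz_ltE, eval_var, eval_at₂ h0 (show 2 ≠ 9 by decide),
      Function.update_self, Function.update_of_ne (show 2 ≠ 3 by decide), h3, h6, Fin.val_fin_lt]
    refine and_congr_right fun h => and_congr_right fun _ => not_congr ?_
    exact or_iff_right h.ne
  replace h17 : M 17 0 = I.k - I.forced := by
    rw [h17]
    simp [eval_sub, eval_regE, h1, h16]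
  replace h18 : M 18 0 = I.excess := by
    rw [h18, eval_cntE h0]
    simp [nz_exE h0, nz_andE, nz_ltE, eval_at₁, eval_add, eval_lit, eval_var, eval_twoK, h1, h7,
      h9, Instance.excess]
  replace h19 : M 19 0 = min (I.η - I.excess) I.keptNum := by
    rw [h19]
    simp only [eval_sub, eval_regE, h2, h14, h18]
    omega
  -- a product can be computed only if a factor is at most `n`; capping one factor is harmless,
  -- because the product is compared with a number of vertices
  have hsum : (sum 2 (ite (ltE (var 2) twoK) twoK (lit 0))).eval M (fun _ => 0) =
      min I.n (2 * I.k) * (2 * I.k) := by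
    classical
    have hc : cnt (fun i : Fin I.n => (i : ℕ) < 2 * I.k) = min I.n (2 * I.k) := by
      rw [cnt_eq_card]
      simp [Fin.card_filter_val_lt]
    rw [← hc, eval_sum h0, cnt_eq_card, Finset.card_filter, Finset.sum_mul]
    refine Finset.sum_congr rfl fun i _ => ?_
    simp [eval_ite, nz_ltE, eval_var, eval_lit, eval_twoK, h1]
  refine ⟨h0, h6, h9, h12, h13, h14, h15, h17, h19, ?_⟩
  rw [h20, nz_orE, nz_orE, nz_ltE (x := sum _ _), hsum]
  have hle : cnt (fun v => ¬ Iso I.base v) ≤ I.n := (cnt_le_card _).trans (Fintype.card_fin _).le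
  have hmin : min I.n (2 * I.k) * (2 * I.k) < cnt (fun v => ¬ Iso I.base v) ↔
      2 * I.k * (2 * I.k) < cnt (fun v => ¬ Iso I.base v) := by
    rcases le_total (2 * I.k) I.n with h | h
    · rw [min_eq_right h]
    · rw [min_eq_left h]
      have h1 : 2 * I.k = 0 ∨ I.n ≤ I.n * (2 * I.k) := by
        rcases Nat.eq_zero_or_pos (2 * I.k) with h | h
        · exact Or.inl h
        · exact Or.inr (Nat.le_mul_of_pos_right _ h)
      have h2 := Nat.mul_le_mul_right (2 * I.k) h
      rcases h1 with h1 | h1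
      · rw [h1] at h ⊢
        omega
      · omega
  rw [Instance.Bad, ← hmin]
  simp [nz_exE h0, nz_andE, nz_notE, nz_ltE, eval_cntE h0, eval_at₁, eval_add, eval_regE,
    h1, h2, h7, h8, h9, h16]

lemma rank_enum (I : Instance) (i : Fin I.keptNum) :
    BCD.rank (Kept I.base I.k) (I.enum i) = i := by
  classical
  have : cnt (fun j : Fin I.keptNum => j < i) = i := by
    rw [cnt_eq_card, ← Fin.card_Iio i]
    congr 1
    ext
    simp
  rw [← this]
  refine (cnt_comp_eq I.enum.injective (fun j => ?_) fun v hv => (I.kept_iff v).1 hv.2).symm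
  rw [I.enum.lt_iff_lt]
  exact (and_iff_left ((I.kept_iff _).2 ⟨j, rfl⟩)).symm

/-- The number of steps of `kernelProgram`, as a polynomial in the number of vertices. -/
noncomputable def kernelTime : Polynomial ℕ := times analysis + (times output + 50)

lemma kernelProgram_runs (I : Instance) :
    Runs kernelProgram (kernelTime.eval I.n) I.encode I.kernel.IsOutput := by
  classical
  have hruns := progs_runs analysis analysis_wellFormed I.encode
  rw [show I.encode 0 0 = I.n from rfl] at hruns
  rw [kernelTime, Polynomial.eval_add]
  refine hruns.seq fun M hM => ?_
  have hkeep : ∀ b < 4, M b = I.encode b := fun b hb =>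
    hM.1 b (hb.trans (by decide)) (by
      rw [show analysis.map target = [4, 5, 6, 7, 8, 9, 10, 11, 12, 13, 14, 15, 16, 17, 18, 19, 20]
        from rfl]
      simp only [List.mem_cons, List.not_mem_nil, or_false]
      omega)
  have hA : Analysed I M := analysed I M (by rw [hkeep 0 (by omega)]; rfl)
    (by rw [hkeep 1 (by omega)]; rfl) (by rw [hkeep 2 (by omega)]; rfl)
    (by rw [hkeep 3 (by omega)]; exact encode_adj I) hM.2
  have h50 : Polynomial.eval I.n 50 = 50 := by simp
  rw [Polynomial.eval_add, h50]
  by_cases hbad : I.Bad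
  · obtain ⟨t, M', h1, h2, h3⟩ := writeNo_runs M
    refine ⟨_, M', .ite_true ?_ h1, ?_, ?_⟩
    · exact hA.bad.2 hbad
    · simp only [Expr.cost]; omega
    · rwa [Instance.kernel, if_pos hbad]
  have hrun₂ := progs_runs output output_wellFormed M
  rw [hA.n_eq] at hrun₂
  obtain ⟨t, M'', h1, h2, h3⟩ := hrun₂.seq (q := .store 0 (.lit 0) (reg 14))
    (R := I.kernel.IsOutput) (T := 4) fun M' hM' => by
      obtain ⟨hk, hout⟩ := hM'
      have hsame : ∀ b < scratch, b ≠ 1 → b ≠ 2 → b ≠ 3 → M' b = M b := fun b hb h1 h2 h3 =>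
        hk b hb (by simp [output, target]; omega)
      simp only [output, List.mem_cons, List.not_mem_nil, or_false, forall_eq_or_imp, forall_eq,
        Holds] at hout
      obtain ⟨o3, o1, o2⟩ := hout
      have e0 : M' 0 0 = I.n := by
        rw [hsame 0 (by decide) (by decide) (by decide) (by decide), hA.n_eq]
      refine Runs.store (by simp [Expr.cost]) ?_
      rw [Instance.kernel, if_neg hbad]
      refine ⟨?_, ?_, ?_, ?_⟩
      · simp only [Function.update_self, Expr.eval]
        rw [hsame 14 (by decide) (by decide) (by decide) (by decide), hA.num]
        rfl
      · rw [Function.update_of_ne (by decide), o1, eval_regE,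
          hsame 17 (by decide) (by decide) (by decide) (by decide), hA.k_eq]
        rfl
      · rw [Function.update_of_ne (by decide), o2, eval_regE,
          hsame 19 (by decide) (by decide) (by decide) (by decide), hA.η_eq]
        rfl
      · intro u v
        rw [Function.update_of_ne (by decide)]
        change Fin I.keptNum at u v
        change M' 3 ((u : ℕ) * I.keptNum + v) = if (merged I.base I.k).Adj (I.enum u) (I.enum v)
          then 1 else 0
        have hnum : I.keptNum ≤ I.n := (cnt_le_card _).trans (Fintype.card_fin _).le
        set q := (u : ℕ) * I.keptNum + v with hq
        have hqlt : q < I.n * I.n := by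
          have a1 := Nat.mul_le_mul_right I.keptNum (Nat.succ_le_of_lt u.2)
          rw [Nat.succ_mul] at a1
          have a2 := Nat.mul_le_mul hnum hnum
          have := v.2
          omega
        have hn0 : 0 < I.n := by
          by_contra h
          rw [Nat.eq_zero_of_not_pos h] at hqlt
          omega
        have o3q := o3 (q / I.n) (Nat.div_lt_of_lt_mul hqlt) (q % I.n) (Nat.mod_lt _ hn0)
        have hqn : q / I.n * I.n + q % I.n = q := Nat.div_add_mod' _ _
        rw [hqn] at o3q
        rw [o3q]
        have e6 := hsame 6 (by decide) (by decide) (by decide) (by decide)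
        have e9 := hsame 9 (by decide) (by decide) (by decide) (by decide)
        have e12 := hsame 12 (by decide) (by decide) (by decide) (by decide)
        have e13 := hsame 13 (by decide) (by decide) (by decide) (by decide)
        have e15 := hsame 15 (by decide) (by decide) (by decide) (by decide)
        have key : NZ ((exE 2 (exE 3 (andE (at₁ 12 2) (andE (at₁ 12 3)
            (andE (eqE (add (at₁ 15 2) (at₁ 13 3)) (add (sum 9 (var 0)) (var 1)))
            (andE (notE (eqE (var 2) (var 3)))
            (orE (andE (at₁ 9 2) (at₁ 9 3)) (at₂ 6 2 3)))))))).eval M'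
              fun v => if v = 0 then q / I.n else q % I.n) ↔
            (merged I.base I.k).Adj (I.enum u) (I.enum v) := by
          simp [nz_exE e0, nz_andE, nz_orE, nz_eqE, nz_notE, eval_at₁, eval_at₂ e0, eval_add,
            eval_var, eval_sum e0, e6, e9, e12, e13, e15, hA.kept, hA.rank, hA.rank_mul,
            hA.large, hA.relB,
            Fin.val_inj, mul_comm I.n, hqn]
          constructor
          · rintro ⟨a, ha, b, hb, hab, hne, h⟩
            obtain ⟨i, rfl⟩ := (I.kept_iff a).1 ha
            obtain ⟨j, rfl⟩ := (I.kept_iff b).1 hb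
            rw [rank_enum, rank_enum, hq] at hab
            have hpos : 0 < I.keptNum := u.pos
            have hi : i = u := by
              have := congrArg (· / I.keptNum) hab
              simp only [mul_comm _ I.keptNum, Nat.mul_add_div hpos, Nat.div_eq_of_lt j.2,
                Nat.div_eq_of_lt v.2, add_zero] at this
              exact Fin.ext this
            subst hi
            have hj : j = v := Fin.ext (Nat.add_left_cancel hab)
            subst hj
            exact h.imp (fun h => ⟨hne, h⟩) fun h => h.resolve_left hne
          · intro h
            refine ⟨_, (I.kept_iff _).2 ⟨u, rfl⟩, _, (I.kept_iff _).2 ⟨v, rfl⟩, ?_, h.ne, ?_⟩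
            · rw [rank_enum, rank_enum]
            · exact h.imp And.right Or.inr
        rw [eval_ite]
        simp only [key, eval_lit]
  · refine ⟨_, M'', .ite_false ?_ h1, ?_, h3⟩
    · by_contra h
      exact hbad (hA.bad.1 h)
    · simp only [Expr.cost]; omega

lemma eval_le_eval (q : Polynomial ℕ) {m n : ℕ} (h : m ≤ n) : q.eval m ≤ q.eval n := by
  rw [Polynomial.eval_eq_sum, Polynomial.eval_eq_sum]
  exact Finset.sum_le_sum fun i _ => Nat.mul_le_mul_left _ (Nat.pow_le_pow_left h i)

lemma isPolyTime_kernel : IsPolyTime Instance.kernel := by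
  refine ⟨kernelProgram, kernelTime, fun I => ?_⟩
  obtain ⟨t, M, h1, h2, h3⟩ := kernelProgram_runs I
  refine ⟨t, M, h1, h2.trans (eval_le_eval _ ?_), h3⟩
  have : I.n ≤ I.n ^ 2 := Nat.le_self_pow two_ne_zero _
  unfold Instance.size
  omega

end KernelProgram

end BCD

theorem mainTheorem2 :
    ∃ K : BCD.Instance → BCD.Instance, BCD.IsKernelization K ∧
      ∃ C : ℕ, ∀ I : BCD.Instance, (K I).n ≤ C * (I.k ^ 4 + 1) :=
  ⟨BCD.Instance.kernel, ⟨BCD.isPolyTime_kernel, BCD.Instance.kernel_isYes, BCD.sizeBound,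
    BCD.computable_sizeBound, BCD.size_kernel_le⟩, 25, BCD.Instance.kernel_n_le⟩
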